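/- **Setting.** Let $X$ be a measurable space and $\mathcal H$ a class of measurable functions $X\to\{-1,+1\}$ of VC-dimension $d\in\mathbb N$ satisfying the usual measurability convention of VC theory: for i.i.d. points $x_1,\dots,x_n$ and fixed labels $s_1,\dots,s_n$, "some $h\in\mathcal H$ has $h(x_i)=s_i$ for all $i$" is an event (up to a null set), whatever the law of the $x_i$. For a probability distribution $\mathcal D$ on $X$ and a ground truth $g\in\mathcal H$ put $R_{\mathcal D,g}(f)=\mathbb P_{x\sim\mathcal D}[f(x)\ne g(x)]$. The equivalence query oracle $\mathrm{EQ}_{\mathcal D}$, asked a query $f:X\to\{-1,+1\}$, returns a fresh random counterexample $x\sim\mathcal D|_{f\neq g}$, or "YES" if $R_{\mathcal D,g}(f)=0$; $\mathrm{EQ}_{\mathcal D}(f,m)$ denotes $m$ independent such queries. The learner knows neither $g$ nor $\mathcal D$. A counterexample $x$ to $f$ is used as the labelled example $(x,-f(x))$; the answer "YES" contributes no example. $\log$ is to base $2$. **Votes.** For an odd integer $B\geq 1$ let $\mathrm{clip}(z)=\min(\max(-B,z),B)$, $\mathrm{Vote}(h_1)(x)=h_1(x)$, $\mathrm{Vote}(h_1,\dots,h_i)(x)=\mathrm{clip}\big(\mathrm{Vote}(h_1,\dots,h_{i-1})(x)+2h_i(x)\big)$,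 and let $\mathrm{Maj}(h_1,\dots,h_i)(x)$ be $+1$ if $\mathrm{Vote}(h_1,\dots,h_i)(x)\ge 0$ and $-1$ otherwise. For $A\subseteq X$ let $f\oplus A$ be $f$ with its values negated on $A$. **Algorithm EQlearner** (parameters $\epsilon,\delta,\mathcal H$; constants $a,b>0$). Put $\epsilon'=\epsilon/(10^5\log^4(1/\epsilon))$, $B=2\lceil\log(1/\epsilon')\rceil+1$, $m=\lceil a\,(d+\log(B^4)+\log(1/\delta))\,B^4\rceil$, $t=\lceil b\,B^3\rceil$. Take any $h_1\in\mathcal H$. For $i=2,\dots,t$: draw $S_i=\mathrm{EQ}_{\mathcal D}(\mathrm{Maj}(h_1,\dots,h_{i-1}),m)$; for each odd $v\in\{1,\dots,B\}$ draw $S_i^v=\mathrm{EQ}_{\mathcal D}(h',m)$ with $h'=\mathrm{Maj}(h_1,\dots,h_{i-1})\oplus\{x:\mathrm{Vote}(h_1,\dots,h_{i-1})(x)\in\{v,-v\}\}$; let $h_i\in\mathcal H$ be a hypothesis consistent with $S_i\cup\bigcup_v S_i^v$, chosen by an arbitrary procedure FindConsistent that returns a consistent element of $\mathcal H$ whenever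 there is one. Return $\mathrm{Maj}(h_1,\dots,h_t)$. **Theorem.** There are universal constants $a,b,C>0$ such that for all $\epsilon\in(0,\tfrac1{32})$, $\delta\in(0,1)$, all $X$, $d$ and $\mathcal H$ of VC-dimension $d$ as above, every choice of $h_1\in\mathcal H$ and every FindConsistent procedure, EQlearner run with parameters $\epsilon,\delta,\mathcal H$ (and constants $a,b$) * EQ-learns $\mathcal H$: for every ground truth $g\in\mathcal H$ and every probability distribution $\mathcal D$ on $X$, with probability at least $1-\delta$ it returns $f:X\to\{-1,+1\}$ with $R_{\mathcal D,g}(f)\le\epsilon$; and * always asks at most $C\,\big(\max(d,1)+\log(1/\delta)\big)\log^9(1/\epsilon)$ equivalence queries. -/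

import Mathlib

open MeasureTheory ProbabilityTheory
open scoped ENNReal

universe u v

namespace EQL

/-! ### Hypothesis classes

Labels are the units `{1, -1}` of `ℤ`; a classifier on `X` is a function `X → ℤˣ`. -/

/-- `H` realizes every labelling of the finite set `A`. -/
def Shatters {X : Type u} (H : Set (X → ℤˣ)) (A : Finset X) : Prop :=
  ∀ s : X → ℤˣ, ∃ h ∈ H, ∀ x ∈ A, h x = s x

/-- `H` has VC-dimension `d`: the largest shattered finite set has `d` points. -/
def HasVCDim {X : Type u} (H : Set (X → ℤˣ)) (d : ℕ) : Prop :=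
  (∃ A : Finset X, A.card = d ∧ Shatters H A) ∧ ∀ A : Finset X, Shatters H A → A.card ≤ d

/-- The measurability convention of VC theory: hypotheses are measurable, and for i.i.d. points
`x₁, …, xₙ` and fixed labels `s₁, …, sₙ`, "some hypothesis is consistent with
`(x₁, s₁), …, (xₙ, sₙ)`" is an event (up to a null set). -/
structure IsMeasurableClass {X : Type u} [MeasurableSpace X] (H : Set (X → ℤˣ)) : Prop where
  measurable : ∀ h ∈ H, Measurable h
  nullMeasurableSet_consistent : ∀ (P : Measure X) [IsProbabilityMeasure P] (n : ℕ)
    (s : Fin n → ℤˣ),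
    NullMeasurableSet {x : Fin n → X | ∃ h ∈ H, ∀ i, h (x i) = s i} (Measure.pi fun _ => P)

/-- `h` agrees with all labelled examples of the sample `S`. -/
def Consistent {X : Type u} (h : X → ℤˣ) (S : List (X × ℤˣ)) : Prop :=
  ∀ p ∈ S, h p.1 = p.2

/-- `FC` is a FindConsistent procedure for `H`: on a sample that is consistent with some
hypothesis of `H` it returns one. -/
def IsFindConsistent {X : Type u} (H : Set (X → ℤˣ)) (FC : List (X × ℤˣ) → X → ℤˣ) : Prop :=
  ∀ S, (∃ h ∈ H, Consistent h S) → FC S ∈ H ∧ Consistent (FC S) S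

/-- The risk `ℙ_{x ∼ D}[f x ≠ g x]` of `f` with respect to the ground truth `g`. -/
noncomputable def risk {X : Type u} [MeasurableSpace X] (D : Measure X) (g f : X → ℤˣ) : ℝ :=
  D.real {x | f x ≠ g x}

/-! ### Learning from random counterexamples -/

/-- Algorithms that interact with an equivalence query oracle: either return a result, or submit a
classifier `f` and continue depending on the reply, which is a counterexample `some x`, or `none`,
standing for the reply "YES". -/
inductive EQProg (X : Type u) (α : Type v) : Type (max u v)
  | ret (a : α) : EQProg X α
  | ask (f : X → ℤˣ) (k : Option X → EQProg X α) : EQProg X α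

namespace EQProg

/-- Sequential composition. -/
def bind {X : Type u} {α β : Type v} : EQProg X α → (α → EQProg X β) → EQProg X β
  | ret a, F => F a
  | ask f k, F => ask f fun r => (k r).bind F

instance {X : Type u} : Monad (EQProg.{u, v} X) where
  pure := EQProg.ret
  bind := EQProg.bind

/-- On every sequence of replies, at most `n` equivalence queries are asked. -/
inductive AsksAtMost {X : Type u} {α : Type v} : EQProg X α → ℕ → Prop
  | ret (a : α) (n : ℕ) : AsksAtMost (EQProg.ret a) n
  | ask (f : X → ℤˣ) (k : Option X → EQProg X α) (n : ℕ) (hk : ∀ r, AsksAtMost (k r) n) :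
      AsksAtMost (EQProg.ask f k) (n + 1)

open Classical in
/-- The probability that the result of the algorithm lies in `E`, when each query `f` is answered,
independently of the past, by a random `x ∼ D|_{f ≠ g}`, or by "YES" if `f` has risk zero
(`g` is the ground truth). If the choices made by the algorithm depend on the replies in a
non-measurable way, `∫⁻` is the lower integral, so that this is a lower bound for the probability
in any reasonable sense. -/
noncomputable def prob {X : Type u} {α : Type v} [MeasurableSpace X] (D : Measure X) (g : X → ℤˣ) :
    EQProg X α → Set α → ℝ≥0∞
  | ret a, E => if a ∈ E then 1 else 0
  | ask f k, E =>
      if D {x | f x ≠ g x} = 0 then prob D g (k none) E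
      else ∫⁻ x, prob D g (k (some x)) E ∂(D[|{x | f x ≠ g x}])

end EQProg

/-- The algorithm `L`, designed for error `ε` and confidence `δ`, learns every ground truth of `H`
under every distribution from random counterexamples. -/
def EQLearns {X : Type u} [MeasurableSpace X] (L : EQProg X (X → ℤˣ)) (H : Set (X → ℤˣ))
    (ε δ : ℝ) : Prop :=
  ∀ g ∈ H, ∀ (D : Measure X) [IsProbabilityMeasure D],
    ENNReal.ofReal (1 - δ) ≤ L.prob D g {f | risk D g f ≤ ε}

/-! ### Clipped votes

Lists of classifiers are written with the most recent one first. -/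

/-- Clipping to `[-B, B]`. -/
def clip (B : ℕ) (z : ℤ) : ℤ := min (max (-(B : ℤ)) z) B

/-- `vote B [hᵢ, …, h₁] x`. The value at the empty list is irrelevant. -/
def vote {X : Type u} (B : ℕ) : List (X → ℤˣ) → X → ℤ
  | [], _ => 0
  | [h], x => (h x : ℤ)
  | h :: h' :: hs, x => clip B (vote B (h' :: hs) x + 2 * (h x : ℤ))

/-- The sign of the vote. -/
def maj {X : Type u} (B : ℕ) (hs : List (X → ℤˣ)) (x : X) : ℤˣ :=
  if 0 ≤ vote B hs x then 1 else -1

open Classical in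
/-- `f ⊕ A`: flip the predictions of `f` on `A`. -/
noncomputable def flipOn {X : Type u} (f : X → ℤˣ) (A : Set X) (x : X) : ℤˣ :=
  if x ∈ A then -f x else f x

/-! ### The EQ-learner -/

/-- The internal accuracy `ε' = ε / (10⁵ log⁴(1/ε))`. -/
noncomputable def innerEps (ε : ℝ) : ℝ := ε / (10 ^ 5 * Real.logb 2 (1 / ε) ^ 4)

/-- The clipping level `B_{ε'} = 2⌈log(1/ε')⌉ + 1` for the internal accuracy `ε'`. -/
noncomputable def clipLevel (ε : ℝ) : ℕ := 2 * ⌈Real.logb 2 (1 / innerEps ε)⌉₊ + 1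

/-- The sample size `m = O((d + log(B⁴) + log(1/δ)) B⁴)` with leading constant `a`. -/
noncomputable def sampleSize (a : ℝ) (d : ℕ) (ε δ : ℝ) : ℕ :=
  ⌈a * ((d + Real.logb 2 ((clipLevel ε : ℝ) ^ 4) + Real.logb 2 (1 / δ))
    * (clipLevel ε : ℝ) ^ 4)⌉₊

/-- The number `t = O(B³)` of hypotheses, with leading constant `b`. -/
noncomputable def numRounds (b ε : ℝ) : ℕ := ⌈b * (clipLevel ε : ℝ) ^ 3⌉₊

/-- Submit `f` to the oracle `m` times. Every counterexample `x` to `f` has the true label `-f x`;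
the reply "YES" yields no example. -/
def sampleEQ {X : Type u} (f : X → ℤˣ) : ℕ → EQProg X (List (X × ℤˣ))
  | 0 => pure []
  | m + 1 => EQProg.ask f fun r => do
      let S ← sampleEQ f m
      pure (r.toList.map (fun x => (x, -f x)) ++ S)

/-- The inner loop: for every `v` of the list, `m` counterexamples to the current majority vote
flipped at the points with vote `±v`. -/
noncomputable def sampleFlipped {X : Type u} (B m : ℕ) (hs : List (X → ℤˣ)) :
    List ℕ → EQProg X (List (X × ℤˣ))
  | [] => pure []
  | v :: vs => do
      let S ← sampleEQ (flipOn (maj B hs) {x | vote B hs x = v ∨ vote B hs x = -v}) m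
      let S' ← sampleFlipped B m hs vs
      pure (S ++ S')

/-- One iteration of the outer loop, with `v` ranging over the odd numbers in `{1, …, B}`. -/
noncomputable def step {X : Type u} (FC : List (X × ℤˣ) → X → ℤˣ) (B m : ℕ)
    (hs : List (X → ℤˣ)) : EQProg X (List (X → ℤˣ)) := do
  let S ← sampleEQ (maj B hs) m
  let S' ← sampleFlipped B m hs ((List.range (B + 1)).filter fun v => v % 2 = 1)
  pure (FC (S ++ S') :: hs)

/-- `n` iterations of the outer loop. -/
noncomputable def steps {X : Type u} (FC : List (X × ℤˣ) → X → ℤˣ) (B m : ℕ) :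
    ℕ → List (X → ℤˣ) → EQProg X (List (X → ℤˣ))
  | 0, hs => pure hs
  | n + 1, hs => do
      let hs' ← step FC B m hs
      steps FC B m n hs'

/-- The algorithm EQlearner with constants `a`, `b` in its sample size and its number of rounds,
FindConsistent procedure `FC`, first hypothesis `h₁`, VC-dimension `d`, target error `ε` and
target confidence `δ`. -/
noncomputable def eqLearner {X : Type u} (a b : ℝ) (FC : List (X × ℤˣ) → X → ℤˣ) (h₁ : X → ℤˣ)
    (d : ℕ) (ε δ : ℝ) : EQProg X (X → ℤˣ) := do
  let hs ← steps FC (clipLevel ε) (sampleSize a d ε δ) (numRounds b ε - 1) [h₁]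
  pure (maj (clipLevel ε) hs)

end EQL

namespace EQL

/-! ### Sauer–Shelah for error patterns -/

/-! Write `B = 2K - 1` and follow the margin `g(x) * Vote(x)`, an odd number in `[-B, B]` that is
negative exactly where the majority errs. Give a positive margin `2j+1` the weight `4^(K-1-j)` and a
negative margin `-(2j+1)` the weight `4^K (1 + j/B)`; the potential is the expected weight under
`D`, so the risk is at most potential / `4^K`.

A correct vote multiplies the weight by at most `1 - 1/(2B)`, up to an additive 1 that pays for the
top level, where clipping stops the progress (`weight_succ_le`). A wrong vote costs at most four
times the old weight on a positive level and `2 * 4^K` on a negative one (`weight_pred_le`). It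
remains to bound the mass of wrong votes level by level, and the queries are designed for this. The
majority errs exactly on the negative margins, and the version flipped at `±v` errs on level `v` and
on the negative margins other than `-v` (`flipLevel_ne_iff`). A hypothesis with error at most `γ =
1/(16B)` relative to each of these regions therefore errs on level `v` with mass at most `γ` times
the mass of level `v` plus the negative mass. As the weights grow geometrically, all errors together
cost at most `4γ` times the potential, half of what correct votes gain. Hence potential' ≤ `(1 -
1/(4B))` potential + 1 (`potential_cons_le`). Starting from at most `4^K`, after `B^3 - 1` rounds
the potential is at most `4B + 1`, and `4^K` is so large that the risk is at most `ε`.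

The relative error `γ` comes from the VC bound for consistent hypotheses, applied to `D` conditioned
on the error region of the query: counterexamples are i.i.d. from that law, with labels known to be
correct (`exists_good_samples`, `le_prob_goodSample`). There are at most `B^4` batches of queries,
each failing with probability at most `δ / B^4`. Since FindConsistent may be non-measurable,
probabilities are only bounded below, through lower integrals that compose along the program
(`EQProg.prob_bind_ge`). -/

theorem sum_choose_le {x : ℝ} (hx : 0 < x) (hx1 : x ≤ 1) (n d : ℕ) :
    ∑ k ∈ Finset.Iic d, (n.choose k : ℝ) ≤ (1 / x) ^ d * (1 + x) ^ n := by
  have h1 : ∀ k ∈ Finset.Iic d, (n.choose k : ℝ) ≤ (1 / x) ^ d * (x ^ k * n.choose k) := by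
    intro k hk
    have hk : k ≤ d := by simpa using hk
    -- The terms `k ≤ d` are inflated by `x^(k-d) ≥ 1` and compared with the full binomial
    -- expansion. Keeping `x` free avoids a case distinction between `n` and `d`; it is fixed only
    -- in the numerical estimate.
    have : 1 ≤ (1 / x) ^ d * x ^ k := by
      rw [one_div, inv_pow, ← div_eq_inv_mul, one_le_div (by positivity)]
      exact pow_le_pow_of_le_one hx.le hx1 hk
    calc (n.choose k : ℝ) ≤ ((1 / x) ^ d * x ^ k) * n.choose k :=
          le_mul_of_one_le_left (by positivity) this
      _ = _ := by ring
  refine (Finset.sum_le_sum h1).trans ?_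
  rw [← Finset.mul_sum]
  refine mul_le_mul_of_nonneg_left ?_ (by positivity)
  have h2 : (1 + x) ^ n = ∑ k ∈ Finset.range (n + 1), x ^ k * n.choose k := by
    rw [add_comm, add_pow]
    simp
  rw [h2, ← Finset.sum_subset (Finset.inter_subset_left (s₁ := Finset.Iic d)
      (s₂ := Finset.range (n + 1)))]
  · exact Finset.sum_le_sum_of_subset_of_nonneg Finset.inter_subset_right
      fun k _ _ => by positivity
  · intro k hk hk'
    have : n < k := by
      simp only [Finset.mem_inter, Finset.mem_range, not_and] at hk'
      have := hk' hk
      omega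
    simp [Nat.choose_eq_zero_of_lt this]

open Classical in
/-- The set of indices on which `h` disagrees with `g`. -/
noncomputable def errSet {X : Type u} {ι : Type*} [Fintype ι] (g h : X → ℤˣ) (z : ι → X) :
    Finset ι := {i | h (z i) ≠ g (z i)}

open Classical in
/-- The error patterns of the hypotheses in `H` along `z`. -/
noncomputable def patterns {X : Type u} {ι : Type*} [Fintype ι] (H : Set (X → ℤˣ)) (g : X → ℤˣ)
    (z : ι → X) : Finset (Finset ι) := {T | ∃ h ∈ H, errSet g h z = T}

theorem mem_errSet {X : Type u} {ι : Type*} [Fintype ι] {g h : X → ℤˣ} {z : ι → X} {i : ι} :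
    i ∈ errSet g h z ↔ h (z i) ≠ g (z i) := by simp [errSet]

theorem mem_patterns {X : Type u} {ι : Type*} [Fintype ι] {H : Set (X → ℤˣ)} {g : X → ℤˣ}
    {z : ι → X} {T : Finset ι} : T ∈ patterns H g z ↔ ∃ h ∈ H, errSet g h z = T := by
  simp [patterns]

open Classical in
-- Shattering an index set by error patterns forces `z` to be injective on it, since repeated points
-- share their errors. A prescribed labelling `s` of the image then corresponds to the error pattern
-- `{s ≠ g}`, so the image is shattered by `H`.
theorem card_le_of_shatters_patterns {X : Type u} {ι : Type*} [Fintype ι]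
    {H : Set (X → ℤˣ)} {g : X → ℤˣ} {z : ι → X} {d : ℕ} (hd : HasVCDim H d) {S : Finset ι}
    (hS : (patterns H g z).Shatters S) : S.card ≤ d := by
  have key : ∀ t ⊆ S, ∃ h ∈ H, ∀ i ∈ S, (h (z i) ≠ g (z i) ↔ i ∈ t) := by
    intro t ht
    obtain ⟨u, hu, hut⟩ := hS ht
    obtain ⟨h, hh, rfl⟩ := mem_patterns.1 hu
    refine ⟨h, hh, fun i hi => ?_⟩
    rw [← hut, Finset.mem_inter, mem_errSet]
    tauto
  have hinj : Set.InjOn z S := by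
    intro i hi j hj hij
    by_contra hne
    obtain ⟨h, -, hh⟩ := key {i} (by simpa using hi)
    have h1 := hh i hi
    have h2 := hh j hj
    rw [hij] at h1
    rw [h1] at h2
    simp [eq_comm] at h2
    exact hne h2
  rw [← Finset.card_image_of_injOn hinj]
  refine hd.2 _ fun s => ?_
  obtain ⟨h, hh, hht⟩ := key (S.filter fun i => s (z i) ≠ g (z i)) (Finset.filter_subset _ _)
  refine ⟨h, hh, fun x hx => ?_⟩
  obtain ⟨i, hi, rfl⟩ := Finset.mem_image.1 hx
  have := hht i hi
  simp only [Finset.mem_filter, hi, true_and] at this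
  rcases Int.units_eq_one_or (h (z i)) with h1 | h1 <;>
  rcases Int.units_eq_one_or (s (z i)) with h2 | h2 <;>
  rcases Int.units_eq_one_or (g (z i)) with h3 | h3 <;> simp_all

theorem card_patterns_le {X : Type u} {ι : Type*} [Fintype ι]
    {H : Set (X → ℤˣ)} (g : X → ℤˣ) (z : ι → X) {d : ℕ} (hd : HasVCDim H d)
    {x : ℝ} (hx : 0 < x) (hx1 : x ≤ 1) :
    ((patterns H g z).card : ℝ) ≤ (1 / x) ^ d * (1 + x) ^ Fintype.card ι := by
  classical
  refine le_trans ?_ (sum_choose_le hx hx1 _ d)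
  have h1 := (patterns H g z).card_le_card_shatterer.trans Finset.card_shatterer_le_sum_vcDim
  have h2 : (patterns H g z).vcDim ≤ d :=
    Finset.sup_le fun S hS => card_le_of_shatters_patterns hd (Finset.mem_shatterer.1 hS)
  have h3 := h1.trans (Finset.sum_le_sum_of_subset (Finset.Iic_subset_Iic.2 h2))
  exact_mod_cast h3

/-! ### Swapping a sample with a ghost sample -/

/-- The permutation of `ι ⊕ ι` that exchanges the two copies of `i` whenever `σ i`. -/
def swapPerm {ι : Type*} (σ : ι → Bool) : Equiv.Perm (ι ⊕ ι) :=
  Function.Involutive.toPerm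
    (Sum.elim (fun i => if σ i then Sum.inr i else Sum.inl i)
      (fun i => if σ i then Sum.inl i else Sum.inr i))
    (by rintro (i | i) <;> by_cases h : σ i <;> simp [h])

theorem swapPerm_inl {ι : Type*} (σ : ι → Bool) (i : ι) :
    swapPerm σ (Sum.inl i) = if σ i then Sum.inr i else Sum.inl i := rfl

open Classical in
/-- At most a fraction `2 ^ (-#T)` of all swaps moves `T` to the second copy. -/
theorem card_swap_le {ι : Type*} [Fintype ι] (T : Finset (ι ⊕ ι)) :
    ((Finset.univ.filter fun σ : ι → Bool => ∀ i, swapPerm σ (Sum.inl i) ∉ T).card : ℝ) ≤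
      2 ^ Fintype.card ι * (1 / 2) ^ T.card := by
  have h1 : (Finset.univ.filter fun σ : ι → Bool => ∀ i, swapPerm σ (Sum.inl i) ∉ T) =
      Fintype.piFinset fun i => Finset.univ.filter fun b : Bool =>
        (if b then Sum.inr i else Sum.inl i : ι ⊕ ι) ∉ T := by
    ext σ
    rw [Finset.mem_filter, Fintype.mem_piFinset]
    simp [swapPerm_inl]
  have h2 : T.card = ∑ i : ι, ((if Sum.inl i ∈ T then 1 else 0) +
      if Sum.inr i ∈ T then 1 else 0) := by
    rw [Finset.sum_add_distrib, ← Fintype.sum_sum_type (fun j => if j ∈ T then 1 else 0)]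
    simp
  rw [h1, Fintype.card_piFinset, h2, ← Finset.prod_pow_eq_pow_sum, ← Finset.card_univ,
    ← Finset.prod_const, ← Finset.prod_mul_distrib]
  push_cast
  -- The choices at different indices are independent. If `T` contains none, one or both copies of
  -- `i`, then 2, 1 or 0 of the two choices are admissible, against the bounds 2, 1 and 1/2.
  refine Finset.prod_le_prod (fun _ _ => by positivity) fun i _ => ?_
  by_cases h3 : Sum.inl i ∈ T <;> by_cases h4 : Sum.inr i ∈ T <;>
    simp [h3, h4, Fintype.univ_bool, Finset.filter_insert,
      Finset.filter_singleton]

open Classical in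
/-- Averaging over swaps: few swaps produce a pattern with `r` errors, all of them in the second
copy. -/
theorem card_bad_swaps_le {X : Type u} {ι : Type*} [Fintype ι] (H : Set (X → ℤˣ)) (g : X → ℤˣ)
    (z : ι ⊕ ι → X) (r : ℕ) :
    ((Finset.univ.filter fun σ : ι → Bool => ∃ h ∈ H,
        (∀ i, h (z (swapPerm σ (Sum.inl i))) = g (z (swapPerm σ (Sum.inl i)))) ∧
          r ≤ (errSet g h z).card).card : ℝ) ≤
      (patterns H g z).card * (2 ^ Fintype.card ι * (1 / 2) ^ r) := by
  have hsub : (Finset.univ.filter fun σ : ι → Bool => ∃ h ∈ H,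
        (∀ i, h (z (swapPerm σ (Sum.inl i))) = g (z (swapPerm σ (Sum.inl i)))) ∧
          r ≤ (errSet g h z).card) ⊆
      ((patterns H g z).filter fun T => r ≤ T.card).biUnion fun T =>
        Finset.univ.filter fun σ : ι → Bool => ∀ i, swapPerm σ (Sum.inl i) ∉ T := by
    intro σ hσ
    obtain ⟨h, hh, h1, h2⟩ := (Finset.mem_filter.1 hσ).2
    simp only [Finset.mem_biUnion, Finset.mem_filter, Finset.mem_univ, true_and]
    exact ⟨errSet g h z, ⟨mem_patterns.2 ⟨h, hh, rfl⟩, h2⟩, fun i => by simp [mem_errSet, h1]⟩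
  have h1 := (Finset.card_le_card hsub).trans Finset.card_biUnion_le
  have h2 : ((∑ T ∈ (patterns H g z).filter fun T => r ≤ T.card,
      (Finset.univ.filter fun σ : ι → Bool => ∀ i, swapPerm σ (Sum.inl i) ∉ T).card : ℕ) : ℝ) ≤
      ∑ T ∈ (patterns H g z).filter fun T => r ≤ T.card, 2 ^ Fintype.card ι * (1 / 2 : ℝ) ^ r := by
    push_cast
    refine Finset.sum_le_sum fun T hT => (card_swap_le T).trans ?_
    refine mul_le_mul_of_nonneg_left ?_ (by positivity)
    exact pow_le_pow_of_le_one (by norm_num) (by norm_num) (Finset.mem_filter.1 hT).2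
  refine (Nat.cast_le.2 h1).trans (h2.trans ?_)
  rw [Finset.sum_const, nsmul_eq_mul]
  refine mul_le_mul_of_nonneg_right ?_ (by positivity)
  exact_mod_cast Finset.card_le_card (Finset.filter_subset _ _)

/-! ### Measurability of pattern events -/

/-- The σ-algebra of `ℤˣ` is pulled back from the discrete one on `ℤ` along an injection. -/
theorem measurableSet_units (s : Set ℤˣ) : MeasurableSet s :=
  ⟨Units.val '' s, MeasurableSet.of_discrete, Set.preimage_image_eq s Units.val_injective⟩

variable {X : Type u} [MeasurableSpace X]

theorem measurableSet_ne {h g : X → ℤˣ} (hh : Measurable h) (hg : Measurable g) :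
    MeasurableSet {x | h x ≠ g x} := by
  have : {x | h x ≠ g x} = ⋃ s : ℤˣ, h ⁻¹' {s} ∩ g ⁻¹' {s}ᶜ := by
    ext x; simp [eq_comm]
  rw [this]
  exact MeasurableSet.iUnion fun s =>
    (hh (measurableSet_units _)).inter (hg (measurableSet_units _))

theorem measurePreserving_comp_equiv {ι κ : Type*} [Fintype ι] [Fintype κ] (P : Measure X)
    [IsProbabilityMeasure P] (e : ι ≃ κ) :
    MeasurePreserving (fun (z : κ → X) i => z (e i)) (Measure.pi fun _ => P)
      (Measure.pi fun _ => P) := by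
  convert measurePreserving_piCongrLeft (fun _ : ι => P) e.symm using 1
  ext z i
  have := Equiv.piCongrLeft_apply_apply (P := fun _ : ι => X) e.symm z (e i)
  rw [e.symm_apply_apply] at this
  rw [MeasurableEquiv.coe_piCongrLeft, this]

theorem nullMeasurableSet_exists_eq {H : Set (X → ℤˣ)} (hH : IsMeasurableClass H) (P : Measure X)
    [IsProbabilityMeasure P] {ι : Type*} [Fintype ι] (s : ι → ℤˣ) :
    NullMeasurableSet {z : ι → X | ∃ h ∈ H, ∀ i, h (z i) = s i} (Measure.pi fun _ => P) := by
  let e := Fintype.equivFin ι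
  have h1 := hH.nullMeasurableSet_consistent P (Fintype.card ι) (fun j => s (e.symm j))
  convert h1.preimage (measurePreserving_comp_equiv P e.symm).quasiMeasurePreserving using 1
  ext z
  simp only [Set.mem_ofPred_eq, Set.mem_preimage]
  exact exists_congr fun h => and_congr_right fun _ => by rw [e.forall_congr_left]

/-- The measurability convention concerns fixed labels, whereas an error pattern is relative to the
varying labels `g (z i)`. Splitting into the finitely many label vectors `t` of `g` makes the labels
of `h` fixed: `t` with signs flipped on `T`. -/
theorem nullMeasurableSet_mem_patterns {H : Set (X → ℤˣ)} (hH : IsMeasurableClass H)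
    {g : X → ℤˣ} (hg : Measurable g) (P : Measure X)
    [IsProbabilityMeasure P] {ι : Type*} [Fintype ι] (T : Finset ι) :
    NullMeasurableSet {z : ι → X | T ∈ patterns H g z} (Measure.pi fun _ => P) := by
  classical
  have : {z : ι → X | T ∈ patterns H g z} = ⋃ t : ι → ℤˣ, {z : ι → X | ∀ i, g (z i) = t i} ∩
      {z : ι → X | ∃ h ∈ H, ∀ i, h (z i) = if i ∈ T then - t i else t i} := by
    ext z
    simp only [Set.mem_ofPred_eq, mem_patterns, Set.mem_iUnion, Set.mem_inter_iff]
    constructor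
    · rintro ⟨h, hh, rfl⟩
      refine ⟨fun i => g (z i), fun i => rfl, h, hh, fun i => ?_⟩
      simp only [mem_errSet]
      split_ifs with h1
      · exact Int.units_ne_iff_eq_neg.1 h1
      · simpa using h1
    · rintro ⟨t, ht, h, hh, hh'⟩
      refine ⟨h, hh, ?_⟩
      ext i
      rw [mem_errSet, hh' i, ht i]
      split_ifs with h1 <;> simp [h1]
  rw [this]
  refine NullMeasurableSet.iUnion fun t => NullMeasurableSet.inter ?_
    (nullMeasurableSet_exists_eq hH P _)
  refine MeasurableSet.nullMeasurableSet ?_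
  have : {z : ι → X | ∀ i, g (z i) = t i} = ⋂ i, (fun z : ι → X => g (z i)) ⁻¹' {t i} := by
    ext; simp
  rw [this]
  exact MeasurableSet.iInter fun i => (hg.comp (measurable_pi_apply i)) (measurableSet_units _)

/-! ### Uniform convergence -/

/-- The double samples on which some hypothesis of `H` errs at least `r` times, but never on the
first half. -/
def doubleBad {X : Type u} {ι : Type*} [Fintype ι] (H : Set (X → ℤˣ)) (g : X → ℤˣ) (r : ℕ) :
    Set (ι ⊕ ι → X) :=
  {z | ∃ h ∈ H, (∀ i, h (z (Sum.inl i)) = g (z (Sum.inl i))) ∧ r ≤ (errSet g h z).card}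

theorem nullMeasurableSet_doubleBad {H : Set (X → ℤˣ)} (hH : IsMeasurableClass H)
    {g : X → ℤˣ} (hg : Measurable g) (P : Measure X) [IsProbabilityMeasure P]
    {ι : Type*} [Fintype ι] (r : ℕ) :
    NullMeasurableSet (doubleBad (ι := ι) H g r) (Measure.pi fun _ => P) := by
  classical
  have : doubleBad (ι := ι) H g r =
      ⋃ T : Finset (ι ⊕ ι), ⋃ _ : (∀ i, Sum.inl i ∉ T) ∧ r ≤ T.card,
        {z : ι ⊕ ι → X | T ∈ patterns H g z} := by
    ext z
    simp only [doubleBad, Set.mem_ofPred_eq, mem_patterns, Set.mem_iUnion]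
    constructor
    · rintro ⟨h, hh, h1, h2⟩
      exact ⟨errSet g h z, ⟨fun i => by simp [mem_errSet, h1], h2⟩, h, hh, rfl⟩
    · rintro ⟨_, ⟨h1, h2⟩, h, hh, rfl⟩
      exact ⟨h, hh, fun i => by simpa [mem_errSet] using h1 i, h2⟩
  rw [this]
  exact NullMeasurableSet.iUnion fun T => NullMeasurableSet.iUnion fun _ =>
    nullMeasurableSet_mem_patterns hH hg P T

theorem card_errSet_comp {X : Type u} {ι : Type*} [Fintype ι] (g h : X → ℤˣ) (z : ι → X)
    (e : Equiv.Perm ι) : (errSet g h fun i => z (e i)).card = (errSet g h z).card := by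
  classical
  refine Finset.card_bij (fun i _ => e i) (fun i hi => ?_) (fun i _ j _ hij => e.injective hij)
    fun j hj => ⟨e.symm j, ?_, by simp⟩
  · simpa [mem_errSet] using hi
  · simpa [mem_errSet] using hj

/-- The product measure is invariant under every swap, so the measure of the bad set is the integral
of the fraction of swaps that make `z` bad. That fraction is bounded pointwise by
`card_bad_swaps_le`. -/
theorem measure_doubleBad_le {H : Set (X → ℤˣ)} (hH : IsMeasurableClass H)
    {g : X → ℤˣ} (hg : Measurable g) (P : Measure X) [IsProbabilityMeasure P]
    {ι : Type*} [Fintype ι] (r : ℕ) {N : ℝ}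
    (hN : ∀ z : ι ⊕ ι → X, ((patterns H g z).card : ℝ) ≤ N) :
    (Measure.pi fun _ => P) (doubleBad (ι := ι) H g r) ≤ ENNReal.ofReal (N * (1 / 2) ^ r) := by
  classical
  set μ : Measure (ι ⊕ ι → X) := Measure.pi fun _ => P
  set S := doubleBad (ι := ι) H g r
  have hS : NullMeasurableSet S μ := nullMeasurableSet_doubleBad hH hg P r
  let F : (ι → Bool) → (ι ⊕ ι → X) → (ι ⊕ ι → X) := fun σ z i => z (swapPerm σ i)
  have hF : ∀ σ, MeasurePreserving (F σ) μ μ := fun σ =>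
    measurePreserving_comp_equiv P (swapPerm σ)
  have hFS : ∀ σ, NullMeasurableSet (F σ ⁻¹' S) μ := fun σ =>
    hS.preimage (hF σ).quasiMeasurePreserving
  have h1 : ∀ z, ∑ σ, (F σ ⁻¹' S).indicator (1 : (ι ⊕ ι → X) → ℝ≥0∞) z ≤
      ENNReal.ofReal (2 ^ Fintype.card ι * (N * (1 / 2) ^ r)) := by
    intro z
    have h2 : ∑ σ, (F σ ⁻¹' S).indicator (1 : (ι ⊕ ι → X) → ℝ≥0∞) z =
        ((Finset.univ.filter fun σ : ι → Bool => F σ z ∈ S).card : ℝ≥0∞) := by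
      simp [Set.indicator_apply]
    have h3 : (Finset.univ.filter fun σ : ι → Bool => F σ z ∈ S) =
        Finset.univ.filter fun σ : ι → Bool => ∃ h ∈ H,
        (∀ i, h (z (swapPerm σ (Sum.inl i))) = g (z (swapPerm σ (Sum.inl i)))) ∧
          r ≤ (errSet g h z).card := by
      ext σ
      simp only [Finset.mem_filter, Finset.mem_univ, true_and, S, doubleBad, Set.mem_ofPred_eq, F,
        card_errSet_comp]
    rw [h2, h3, ← ENNReal.ofReal_natCast]
    refine ENNReal.ofReal_le_ofReal ((card_bad_swaps_le H g z r).trans ?_)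
    calc _ ≤ N * (2 ^ Fintype.card ι * (1 / 2) ^ r) :=
          mul_le_mul_of_nonneg_right (hN z) (by positivity)
      _ = _ := by ring
  have h4 : (2 : ℝ≥0∞) ^ Fintype.card ι * μ S ≤
      2 ^ Fintype.card ι * ENNReal.ofReal (N * (1 / 2) ^ r) := by
    calc (2 : ℝ≥0∞) ^ Fintype.card ι * μ S = ∑ σ : ι → Bool, μ (F σ ⁻¹' S) := by
          rw [Finset.sum_congr rfl fun σ _ => (hF σ).measure_preimage hS]
          simp
      _ = ∑ σ : ι → Bool, ∫⁻ z, (F σ ⁻¹' S).indicator 1 z ∂μ := by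
          simp_rw [fun σ => lintegral_indicator_one₀ (hFS σ)]
      _ = ∫⁻ z, ∑ σ : ι → Bool, (F σ ⁻¹' S).indicator 1 z ∂μ := by
          rw [lintegral_finsetSum']
          exact fun σ _ => aemeasurable_const.indicator₀ (hFS σ)
      _ ≤ ∫⁻ _, ENNReal.ofReal (2 ^ Fintype.card ι * (N * (1 / 2) ^ r)) ∂μ := lintegral_mono h1
      _ = _ := by
          rw [lintegral_const, measure_univ, mul_one, ENNReal.ofReal_mul (by positivity),
            ENNReal.ofReal_pow (by norm_num)]
          simp
  exact (ENNReal.mul_le_mul_iff_right (by simp) (by simp)).1 h4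

/-- A ghost sample most likely witnesses an error of probability at least `γ`. -/
theorem half_le_measure_card_errSet {g h : X → ℤˣ} (hg : Measurable g) (hh : Measurable h)
    (P : Measure X) [IsProbabilityMeasure P] {ι : Type*} [Fintype ι] {γ : ℝ} {r : ℕ}
    (hr : 1 ≤ r) (hrm : 4 * (r : ℝ) ≤ γ * Fintype.card ι) (hγ : γ ≤ P.real {x | h x ≠ g x}) :
    1 / 2 ≤ (Measure.pi fun _ : ι => P) {y | r ≤ (errSet g h y).card} := by
  classical
  set μ : Measure (ι → X) := Measure.pi fun _ => P
  set A := {x | h x ≠ g x}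
  set p := P.real A
  have hA : MeasurableSet A := measurableSet_ne hh hg
  -- A Chernoff argument with base 1/2: the product of the `f (y i)` is `2^(-#errors)`, with mean
  -- `(1 - p/2)^m ≤ exp(-pm/2) ≤ exp(-2r) ≤ 4^(-r)`.
  let f : X → ℝ := fun x => 1 - A.indicator (fun _ => 1 / 2) x
  have hf : Integrable f P := (integrable_const _).sub ((integrable_const _).indicator hA)
  have hfp : ∫ x, f x ∂P = 1 - p / 2 := by
    rw [integral_sub (integrable_const _) ((integrable_const _).indicator hA),
      integral_indicator_const _ hA]
    simp [p]; ring
  have hF : ∀ y : ι → X, ∏ i, f (y i) = (1 / 2) ^ (errSet g h y).card := by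
    intro y
    rw [errSet, Finset.card_filter, ← Finset.prod_pow_eq_pow_sum]
    refine Finset.prod_congr rfl fun i _ => ?_
    by_cases h1 : h (y i) = g (y i) <;> (simp [f, A, h1]; try norm_num)
  have hint : Integrable (fun y : ι → X => ∏ i, f (y i)) μ := Integrable.fintype_prod fun _ => hf
  -- Markov's inequality at the threshold `2 * 2^(-r) = 2^(-(r-1))`, which is reached when there are
  -- at most `r - 1` errors.
  have h1 := mul_meas_ge_le_integral_of_nonneg (μ := μ) (f := fun y : ι → X => ∏ i, f (y i))
    (Filter.Eventually.of_forall fun y => by simp only [hF]; positivity) hint (2 * (1 / 2) ^ r)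
  rw [integral_fintype_prod_eq_prod (fun _ => f)] at h1
  simp only [hfp, Finset.prod_const, Finset.card_univ] at h1
  have hp1 : p ≤ 1 := measureReal_le_one
  have h2 : (1 - p / 2) ^ Fintype.card ι ≤ (1 / 4 : ℝ) ^ r := by
    have h3 : (1 - p / 2) ≤ Real.exp (-(p / 2)) := by
      have := Real.add_one_le_exp (-(p / 2)); linarith
    calc (1 - p / 2) ^ Fintype.card ι ≤ Real.exp (-(p / 2)) ^ Fintype.card ι :=
          pow_le_pow_left₀ (by linarith) h3 _
      _ = Real.exp (-(p / 2) * Fintype.card ι) := by rw [mul_comm, Real.exp_nat_mul]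
      _ ≤ Real.exp (r * (-2)) := by
          refine Real.exp_le_exp.2 ?_
          have : γ * Fintype.card ι ≤ p * Fintype.card ι :=
            mul_le_mul_of_nonneg_right hγ (by positivity)
          linarith
      _ = Real.exp (-2) ^ r := Real.exp_nat_mul _ _
      _ ≤ (1 / 4) ^ r := by
          refine pow_le_pow_left₀ (Real.exp_pos _).le ?_ _
          rw [Real.exp_neg, one_div]
          refine inv_anti₀ (by norm_num) ?_
          have : Real.exp 2 = Real.exp 1 * Real.exp 1 := by rw [← Real.exp_add]; norm_num
          have := Real.exp_one_gt_d9
          nlinarith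
  have h5 : μ.real {y | r ≤ (errSet g h y).card}ᶜ ≤ 1 / 2 := by
    have hsub : {y | r ≤ (errSet g h y).card}ᶜ ⊆
        {y : ι → X | 2 * (1 / 2) ^ r ≤ ∏ i, f (y i)} := by
      intro y hy
      simp only [Set.mem_compl_iff, Set.mem_ofPred_eq, not_le] at hy
      simp only [Set.mem_ofPred_eq, hF]
      calc (2 : ℝ) * (1 / 2) ^ r = (1 / 2) ^ (r - 1) := by
            obtain ⟨k, rfl⟩ := Nat.exists_eq_add_of_le' hr
            simp [pow_succ]; ring
        _ ≤ _ := pow_le_pow_of_le_one (by norm_num) (by norm_num) (by omega)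
    have h6 := measureReal_mono (μ := μ) hsub
    have h7 : (1 / 4 : ℝ) ^ r = (1 / 2) ^ r * (1 / 2) ^ r := by rw [← mul_pow]; norm_num
    have h8 : (0 : ℝ) < (1 / 2) ^ r := by positivity
    have h9 : (1 / 2 : ℝ) ^ r ≤ 1 / 2 := by
      simpa using pow_le_pow_of_le_one (by norm_num : (0:ℝ) ≤ 1/2) (by norm_num) hr
    have h10 : 2 * (1 / 2) ^ r * μ.real {y : ι → X | 2 * (1 / 2) ^ r ≤ ∏ i, f (y i)} ≤
        (1 / 2) ^ r * (1 / 2) ^ r := by rw [← h7]; exact h1.trans h2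
    nlinarith
  have h11 : (1 : ℝ≥0∞) ≤ μ {y | r ≤ (errSet g h y).card} + μ {y | r ≤ (errSet g h y).card}ᶜ := by
    rw [← measure_univ (μ := μ)]
    exact (measure_mono (by simp)).trans (measure_union_le _ _)
  have h12 : μ {y | r ≤ (errSet g h y).card}ᶜ ≤ 1 / 2 := by
    rw [← ofReal_measureReal]
    refine (ENNReal.ofReal_le_ofReal h5).trans ?_
    rw [ENNReal.ofReal_div_of_pos (by norm_num)]
    simp
  have h13 : (1 : ℝ≥0∞) ≤ μ {y | r ≤ (errSet g h y).card} + 1 / 2 := h11.trans (by gcongr)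
  have h14 : (1 : ℝ≥0∞) / 2 + 1 / 2 = 1 := ENNReal.add_halves 1
  rw [← h14] at h13
  exact (ENNReal.add_le_add_iff_right (by simp)).1 (h13.trans_eq (by rw [h14]))

/-- Uniform convergence for consistent hypotheses of a class of VC dimension `d`. -/
theorem exists_good_samples {H : Set (X → ℤˣ)} (hH : IsMeasurableClass H) {d : ℕ}
    (hd : HasVCDim H d) {g : X → ℤˣ} (hg : g ∈ H) (P : Measure X) [IsProbabilityMeasure P]
    {m r : ℕ} {γ x : ℝ} (hr : 1 ≤ r) (hrm : 4 * (r : ℝ) ≤ γ * m) (hx : 0 < x) (hx1 : x ≤ 1) :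
    ∃ G : Set (Fin m → X), MeasurableSet G ∧
      (∀ z ∈ G, ∀ h ∈ H, (∀ i, h (z i) = g (z i)) → P.real {x | h x ≠ g x} ≤ γ) ∧
      1 - ENNReal.ofReal (2 * ((1 / x) ^ d * (1 + x) ^ (2 * m) * (1 / 2) ^ r)) ≤
        (Measure.pi fun _ => P) G := by
  set μ : Measure (Fin m → X) := Measure.pi fun _ => P
  set ν : Measure (Fin m ⊕ Fin m → X) := Measure.pi fun _ => P
  have hgm := hH.measurable g hg
  set S := doubleBad (ι := Fin m) H g r
  have hS : ν S ≤ ENNReal.ofReal ((1 / x) ^ d * (1 + x) ^ (2 * m) * (1 / 2) ^ r) :=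
    measure_doubleBad_le hH hgm P r fun z => by
      have := card_patterns_le g z hd hx hx1
      simpa [two_mul] using this
  -- The bad set is only null measurable. Its measurable hull has the same measure and measurable
  -- sections, so the first samples whose section has mass below 1/2 form a measurable good set.
  -- Markov's inequality, which costs the factor 2, bounds the complement.
  set S' := toMeasurable ν S
  have hS' : MeasurableSet S' := measurableSet_toMeasurable _ _
  let e := (MeasurableEquiv.sumPiEquivProdPi fun _ : Fin m ⊕ Fin m => X).symm
  have he : MeasurePreserving e (μ.prod μ) ν :=
    measurePreserving_sumPiEquivProdPi_symm fun _ : Fin m ⊕ Fin m => P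
  have heS : MeasurableSet (e ⁻¹' S') := e.measurable hS'
  let f : (Fin m → X) → ℝ≥0∞ := fun z => μ (Prod.mk z ⁻¹' (e ⁻¹' S'))
  have hf : Measurable f := measurable_measure_prodMk_left heS
  refine ⟨{z | f z < 1 / 2}, measurableSet_lt hf measurable_const, ?_, ?_⟩
  · intro z hz h hh hcons
    by_contra! hlt
    -- A consistent `h` with error above `γ` would be exposed by at least half of the ghost samples,
    -- so the section over `z` would be too large.
    refine (not_lt.2 ?_ : ¬ f z < 1 / 2) hz
    refine (half_le_measure_card_errSet hgm (hH.measurable h hh) P hr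
      (by simpa using hrm) hlt.le).trans (measure_mono fun y hy => ?_)
    refine subset_toMeasurable ν S ⟨h, hh, hcons, ?_⟩
    refine le_trans (Set.mem_ofPred_eq ▸ hy) (Finset.card_le_card_of_injOn Sum.inr ?_
      Sum.inr_injective.injOn)
    intro i hi
    have hi : h (y i) ≠ g (y i) := mem_errSet.1 hi
    exact Finset.mem_coe.2 (mem_errSet.2 hi)
  · have h1 : μ {z | f z < 1 / 2}ᶜ ≤
        ENNReal.ofReal (2 * ((1 / x) ^ d * (1 + x) ^ (2 * m) * (1 / 2) ^ r)) := by
      have h2 := mul_meas_ge_le_lintegral (μ := μ) hf (1 / 2)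
      have h3 : ∫⁻ z, f z ∂μ = ν S := by
        rw [← measure_toMeasurable S, ← he.measure_preimage_equiv]
        exact (Measure.prod_apply heS).symm
      have h4 : {z | f z < 1 / 2}ᶜ = {z | 1 / 2 ≤ f z} := by ext; simp
      rw [h4, ENNReal.ofReal_mul (by norm_num)]
      calc μ {z | 1 / 2 ≤ f z} = 2 * (1 / 2 * μ {z | 1 / 2 ≤ f z}) := by
            rw [← mul_assoc, one_div, ENNReal.mul_inv_cancel (by simp) (by simp), one_mul]
        _ ≤ 2 * ν S := by rw [← h3]; gcongr
        _ ≤ _ := by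
            rw [show ENNReal.ofReal 2 = 2 by simp]; gcongr
    have hG : MeasurableSet {z | f z < 1 / 2} := measurableSet_lt hf measurable_const
    have h5 := prob_compl_eq_one_sub (μ := μ) hG.compl
    rw [compl_compl] at h5
    rw [h5]
    gcongr

/-! ### Composition of programs -/

namespace EQProg

theorem AsksAtMost.mono {X : Type u} {α : Type v} {p : EQProg X α} {n : ℕ}
    (hp : p.AsksAtMost n) : ∀ {k : ℕ}, n ≤ k → p.AsksAtMost k := by
  induction hp with
  | ret a n => exact fun _ => AsksAtMost.ret a _
  | ask f k n hk ih =>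
    intro j hj
    obtain ⟨j, rfl⟩ := Nat.exists_eq_add_of_le' (Nat.lt_of_lt_of_le n.succ_pos hj)
    exact AsksAtMost.ask f k j fun r => ih r (by omega)

theorem AsksAtMost.bind {X : Type u} {α β : Type v} {p : EQProg X α} {n k : ℕ}
    (hp : p.AsksAtMost n) {F : α → EQProg X β} (hF : ∀ a, (F a).AsksAtMost k) :
    (p.bind F).AsksAtMost (n + k) := by
  induction hp with
  | ret a n => exact (hF a).mono (Nat.le_add_left _ _)
  | ask f q n hk ih =>
    rw [Nat.add_right_comm]
    exact AsksAtMost.ask f _ _ ih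

/-- Success probabilities multiply along a composition because a constant factor can be moved into a
lower integral (`lintegral_mul_const_le`); no measurability of the continuations is needed. -/
theorem prob_bind_ge {X : Type u} {α β : Type v} [MeasurableSpace X] (D : Measure X) (g : X → ℤˣ)
    (p : EQProg X α) (F : α → EQProg X β) (Q : Set α) (E : Set β) {c : ℝ≥0∞}
    (hF : ∀ a ∈ Q, c ≤ (F a).prob D g E) : p.prob D g Q * c ≤ (p.bind F).prob D g E := by
  induction p with
  | ret a =>
    by_cases ha : a ∈ Q
    · simpa [prob, ha, EQProg.bind] using hF a ha
    · simp [prob, ha]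
  | ask f k ih =>
    rw [EQProg.bind, prob, prob]
    split_ifs
    · exact ih _
    · exact (lintegral_mul_const_le _ _).trans (lintegral_mono fun x => ih _)

end EQProg

/-! ### Samples -/

theorem asksAtMost_sampleEQ {X : Type u} (f : X → ℤˣ) (m : ℕ) :
    (sampleEQ f m).AsksAtMost m := by
  induction m with
  | zero => exact EQProg.AsksAtMost.ret _ _
  | succ m ih =>
    exact EQProg.AsksAtMost.ask f _ m fun r => ih.bind (k := 0) fun S => EQProg.AsksAtMost.ret _ _

theorem asksAtMost_sampleFlipped {X : Type u} (B m : ℕ) (hs : List (X → ℤˣ)) (vs : List ℕ) :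
    (sampleFlipped B m hs vs).AsksAtMost (vs.length * m) := by
  induction vs with
  | nil => exact EQProg.AsksAtMost.ret _ _
  | cons v vs ih =>
    have := (asksAtMost_sampleEQ
      (flipOn (maj B hs) {x | vote B hs x = v ∨ vote B hs x = -v}) m).bind
        fun S => ih.bind (k := 0) (F := fun S' => EQProg.ret (S ++ S'))
          fun S' => EQProg.AsksAtMost.ret _ _
    exact this.mono (by rw [List.length_cons]; linarith)

/-- The odd numbers in `{1, …, B}`. -/
def oddLevels (B : ℕ) : List ℕ := (List.range (B + 1)).filter fun v => v % 2 = 1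

theorem asksAtMost_step {X : Type u} (FC : List (X × ℤˣ) → X → ℤˣ) (B m : ℕ)
    (hs : List (X → ℤˣ)) : (step FC B m hs).AsksAtMost (((oddLevels B).length + 1) * m) := by
  have := (asksAtMost_sampleEQ (maj B hs) m).bind
    fun S => (asksAtMost_sampleFlipped B m hs (oddLevels B)).bind (k := 0)
      (F := fun S' => EQProg.ret (FC (S ++ S') :: hs)) fun S' => EQProg.AsksAtMost.ret _ _
  exact this.mono (by linarith)

theorem asksAtMost_steps {X : Type u} (FC : List (X × ℤˣ) → X → ℤˣ) (B m n : ℕ)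
    (hs : List (X → ℤˣ)) :
    (steps FC B m n hs).AsksAtMost (n * (((oddLevels B).length + 1) * m)) := by
  induction n generalizing hs with
  | zero => exact EQProg.AsksAtMost.ret _ _
  | succ n ih =>
    have := (asksAtMost_step FC B m hs).bind fun hs' => ih hs'
    exact this.mono (by linarith)

/-- Repeated queries draw from the product of the conditional laws: splitting off the first
coordinate and applying Fubini matches the recursion of `sampleEQ`. This is an inequality because
`E` is arbitrary, while `G` is measurable. -/
theorem le_prob_sampleEQ (D : Measure X) [IsProbabilityMeasure D] {f g : X → ℤˣ}
    (hA : D {x | f x ≠ g x} ≠ 0) (m : ℕ) {G : Set (Fin m → X)} (hG : MeasurableSet G)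
    {E : Set (List (X × ℤˣ))} (hE : ∀ z ∈ G, List.ofFn (fun i => (z i, -f (z i))) ∈ E) :
    (Measure.pi fun _ => D[|{x | f x ≠ g x}]) G ≤ (sampleEQ f m).prob D g E := by
  have : IsProbabilityMeasure D[|{x | f x ≠ g x}] := cond_isProbabilityMeasure hA
  induction m generalizing E with
  | zero =>
    rcases G.eq_empty_or_nonempty with rfl | ⟨z, hz⟩
    · simp
    · have h0 : ([] : List (X × ℤˣ)) ∈ E := by simpa using hE z hz
      refine prob_le_one.trans_eq ?_
      change 1 = (EQProg.ret []).prob D g E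
      rw [EQProg.prob, if_pos h0]
  | succ m ih =>
    have he := (measurePreserving_piFinSuccAbove
      (fun _ : Fin (m + 1) => D[|{x | f x ≠ g x}]) 0).symm
    have hmeas := he.measurable hG
    rw [← he.measure_preimage_equiv, Measure.prod_apply hmeas]
    change _ ≤ (EQProg.ask f fun r => (sampleEQ f m).bind fun S =>
      EQProg.ret (r.toList.map (fun x => (x, -f x)) ++ S)).prob D g E
    rw [EQProg.prob, if_neg hA]
    refine lintegral_mono fun x => ?_
    have h1 := ih (G := Prod.mk x ⁻¹' ((MeasurableEquiv.piFinSuccAbove (fun _ => X) 0).symm ⁻¹' G))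
      (measurable_prodMk_left hmeas) (E := {S | (x, -f x) :: S ∈ E}) (fun y hy => by
        have := hE _ hy
        simpa [List.ofFn_succ] using this)
    have h2 := EQProg.prob_bind_ge D g (sampleEQ f m) (fun S =>
      EQProg.ret ((some x).toList.map (fun x => (x, -f x)) ++ S)) {S | (x, -f x) :: S ∈ E} E
      (c := 1) (fun S hS => by
        have hS : (x, -f x) :: S ∈ E := hS
        simp [EQProg.prob, hS])
    rw [mul_one] at h2
    exact h1.trans h2

theorem prob_sampleEQ_of_null (D : Measure X) {f g : X → ℤˣ}
    (hA : D {x | f x ≠ g x} = 0) (m : ℕ) {E : Set (List (X × ℤˣ))} (hE : [] ∈ E) :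
    1 ≤ (sampleEQ f m).prob D g E := by
  induction m with
  | zero =>
    change 1 ≤ (EQProg.ret []).prob D g E
    rw [EQProg.prob, if_pos hE]
  | succ m ih =>
    change _ ≤ (EQProg.ask f fun r => (sampleEQ f m).bind fun S =>
      EQProg.ret (r.toList.map (fun x => (x, -f x)) ++ S)).prob D g E
    rw [EQProg.prob, if_pos hA]
    have h2 := EQProg.prob_bind_ge D g (sampleEQ f m) (fun S =>
      EQProg.ret (Option.toList (none : Option X) |>.map (fun x => (x, -f x)) |>.append S)) E E
      (c := 1) (fun S hS => by
        change 1 ≤ (EQProg.ret S).prob D g E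
        rw [EQProg.prob, if_pos hS])
    rw [mul_one] at h2
    exact ih.trans h2

/-- Relative to the error region of `f`, the error of `h` is at most `γ`. -/
def SmallErr (D : Measure X) (g : X → ℤˣ) (γ : ℝ) (f h : X → ℤˣ) : Prop :=
  D.real ({x | f x ≠ g x} ∩ {x | h x ≠ g x}) ≤ γ * D.real {x | f x ≠ g x}

theorem consistent_append {X : Type u} {h : X → ℤˣ} {S S' : List (X × ℤˣ)} :
    Consistent h (S ++ S') ↔ Consistent h S ∧ Consistent h S' := by
  simp only [Consistent, List.mem_append]
  exact ⟨fun H => ⟨fun p hp => H p (.inl hp), fun p hp => H p (.inr hp)⟩,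
    fun H p hp => hp.elim (H.1 p) (H.2 p)⟩

/-- `S` is correctly labelled, and hypotheses consistent with it have small error relative to every
`f` in `F`. -/
def GoodSample (H : Set (X → ℤˣ)) (D : Measure X) (g : X → ℤˣ) (γ : ℝ) (F : Set (X → ℤˣ))
    (S : List (X × ℤˣ)) : Prop :=
  Consistent g S ∧ ∀ h ∈ H, Consistent h S → ∀ f ∈ F, SmallErr D g γ f h

theorem GoodSample.append {H : Set (X → ℤˣ)} {D : Measure X} {g : X → ℤˣ} {γ : ℝ}
    {F F' : Set (X → ℤˣ)} {S S' : List (X × ℤˣ)} (h : GoodSample H D g γ F S)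
    (h' : GoodSample H D g γ F' S') : GoodSample H D g γ (F ∪ F') (S ++ S') :=
  ⟨consistent_append.2 ⟨h.1, h'.1⟩, fun k hk hc f hf =>
    hf.elim (h.2 k hk (consistent_append.1 hc).1 f) (h'.2 k hk (consistent_append.1 hc).2 f)⟩

/-- Under `D` conditioned on `{f ≠ g}`, an absolute error of at most `γ` is exactly the relative
error bound `SmallErr`. If `f` has risk zero, no examples arrive, but `SmallErr` reduces to `0 ≤ 0`.
-/
theorem le_prob_goodSample {H : Set (X → ℤˣ)} (hH : IsMeasurableClass H) {d : ℕ}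
    (hd : HasVCDim H d) {g : X → ℤˣ} (hg : g ∈ H) (D : Measure X) [IsProbabilityMeasure D]
    {m r : ℕ} {γ x : ℝ} (hr : 1 ≤ r) (hrm : 4 * (r : ℝ) ≤ γ * m) (hx : 0 < x)
    (hx1 : x ≤ 1) {f : X → ℤˣ} (hf : Measurable f) :
    1 - ENNReal.ofReal (2 * ((1 / x) ^ d * (1 + x) ^ (2 * m) * (1 / 2) ^ r)) ≤
      (sampleEQ f m).prob D g {S | GoodSample H D g γ {f} S} := by
  have hgm := hH.measurable g hg
  have hAm : MeasurableSet {x | f x ≠ g x} := measurableSet_ne hf hgm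
  by_cases hA : D {x | f x ≠ g x} = 0
  · refine tsub_le_self.trans (prob_sampleEQ_of_null D hA m ⟨by simp [Consistent], ?_⟩)
    intro h _ _ f' hf'
    rw [Set.mem_singleton_iff.1 hf']
    have h0 : D.real {x | f x ≠ g x} = 0 := by simp [measureReal_def, hA]
    have := measureReal_mono (μ := D)
      (Set.inter_subset_left (s := {x | f x ≠ g x}) (t := {x | h x ≠ g x}))
    rw [SmallErr, h0, mul_zero]
    exact this.trans h0.le
  have hQ : IsProbabilityMeasure D[|{x | f x ≠ g x}] := cond_isProbabilityMeasure hA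
  obtain ⟨G, hGm, hG, hGμ⟩ := exists_good_samples hH hd hg D[|{x | f x ≠ g x}] hr hrm hx hx1
  set μ : Measure (Fin m → X) := Measure.pi fun _ => D[|{x | f x ≠ g x}]
  let A : Set (Fin m → X) := Set.univ.pi fun _ => {x | f x ≠ g x}
  have hApi : MeasurableSet A := MeasurableSet.univ_pi fun _ => hAm
  have hA1 : μ A = 1 := by
    rw [Measure.pi_pi, Finset.prod_eq_one]
    intro i _
    rw [cond_apply hAm, Set.inter_self, ENNReal.inv_mul_cancel hA (measure_ne_top _ _)]
  have hAc : μ Aᶜ = 0 := (prob_compl_eq_zero_iff hApi).2 hA1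
  -- Almost surely all points lie in the error region. Restricting to this event makes every label
  -- `-f (z i)` equal to `g (z i)`, so that agreement with the sample means agreement with `g`.
  rw [← measure_inter_conull hAc] at hGμ
  refine hGμ.trans (le_prob_sampleEQ D hA m (hGm.inter hApi) ?_)
  rintro z ⟨hz, hzA⟩
  have hzA' : ∀ i, -f (z i) = g (z i) := fun i => by
    have : f (z i) ≠ g (z i) := hzA i (Set.mem_univ i)
    rw [Int.units_ne_iff_eq_neg.1 this, neg_neg]
  have hc : ∀ h : X → ℤˣ, Consistent h (List.ofFn fun i => (z i, -f (z i))) ↔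
      ∀ i, h (z i) = g (z i) := by
    intro h
    simp [Consistent, List.mem_ofFn, hzA']
  refine ⟨(hc g).2 fun _ => rfl, ?_⟩
  intro h hh hcons f' hf'
  rw [Set.mem_singleton_iff.1 hf']
  have h1 := hG z hz h hh ((hc h).1 hcons)
  rw [measureReal_def, cond_apply hAm, ENNReal.toReal_mul, ENNReal.toReal_inv] at h1
  have h2 : 0 < D.real {x | f x ≠ g x} :=
    ENNReal.toReal_pos hA (measure_ne_top _ _)
  have h3 := (inv_mul_le_iff₀ h2).1 h1
  rwa [mul_comm] at h3

/-! ### Iterations -/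

/-- The classifier that the inner loop queries for the level `v`. -/
noncomputable def flipLevel {X : Type u} (B : ℕ) (hs : List (X → ℤˣ)) (v : ℕ) : X → ℤˣ :=
  flipOn (maj B hs) {x | vote B hs x = v ∨ vote B hs x = -v}

theorem measurable_vote {B : ℕ} {hs : List (X → ℤˣ)} (hhs : ∀ h ∈ hs, Measurable h) :
    Measurable (vote B hs) := by
  have hval : Measurable (Units.val : ℤˣ → ℤ) := fun s _ => measurableSet_units _
  induction hs with
  | nil => exact measurable_const
  | cons h hs ih =>
    have hh : Measurable fun x => (h x : ℤ) := hval.comp (hhs h (by simp))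
    cases hs with
    | nil => exact hh
    | cons h' hs =>
      have := ih fun k hk => hhs k (by simp [List.mem_cons.1 hk])
      have hc : Measurable (clip B) := fun s _ => MeasurableSet.of_discrete
      exact hc.comp (this.add (hh.const_mul 2))

theorem measurable_maj {B : ℕ} {hs : List (X → ℤˣ)} (hhs : ∀ h ∈ hs, Measurable h) :
    Measurable (maj B hs) :=
  Measurable.ite (measurable_vote hhs (MeasurableSet.of_discrete (s := {v : ℤ | 0 ≤ v})))
    measurable_const measurable_const

theorem measurable_flipLevel {B : ℕ} {hs : List (X → ℤˣ)} (hhs : ∀ h ∈ hs, Measurable h) (v : ℕ) :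
    Measurable (flipLevel B hs v) := by
  classical
  have hneg : Measurable (fun s : ℤˣ => -s) := fun s _ => measurableSet_units _
  exact Measurable.ite (measurable_vote hhs
    (MeasurableSet.of_discrete (s := {w : ℤ | w = v ∨ w = -v})))
    (hneg.comp (measurable_maj hhs)) (measurable_maj hhs)

/-- `h` has small error relative to all classifiers queried in the round after `hs`. -/
def GoodNext (D : Measure X) (g : X → ℤˣ) (γ : ℝ) (B : ℕ) (hs : List (X → ℤˣ)) (h : X → ℤˣ) :
    Prop :=
  SmallErr D g γ (maj B hs) h ∧ ∀ v ∈ oddLevels B, SmallErr D g γ (flipLevel B hs v) h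

theorem le_prob_sampleFlipped {H : Set (X → ℤˣ)} {D : Measure X} {g : X → ℤˣ} {γ : ℝ} {m : ℕ}
    {c : ℝ≥0∞} (hc : ∀ f : X → ℤˣ, Measurable f →
      c ≤ (sampleEQ f m).prob D g {S | GoodSample H D g γ {f} S})
    {B : ℕ} {hs : List (X → ℤˣ)} (hhs : ∀ h ∈ hs, Measurable h) (vs : List ℕ) :
    c ^ vs.length ≤ (sampleFlipped B m hs vs).prob D g
      {S | GoodSample H D g γ {f | ∃ v ∈ vs, f = flipLevel B hs v} S} := by
  induction vs with
  | nil =>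
    change _ ≤ (EQProg.ret []).prob D g _
    rw [EQProg.prob, if_pos]
    · simp
    · exact ⟨by simp [Consistent], fun h _ _ f hf => by simp at hf⟩
  | cons v vs ih =>
    rw [List.length_cons, pow_succ']
    have h1 := EQProg.prob_bind_ge D g (sampleEQ (flipLevel B hs v) m)
      (fun S => (sampleFlipped B m hs vs).bind fun S' => EQProg.ret (S ++ S'))
      {S | GoodSample H D g γ {flipLevel B hs v} S}
      {S | GoodSample H D g γ {f | ∃ v' ∈ v :: vs, f = flipLevel B hs v'} S}
      (c := c ^ vs.length) (fun S hS => by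
        have h2 := EQProg.prob_bind_ge D g (sampleFlipped B m hs vs)
          (fun S' => EQProg.ret (S ++ S'))
          {S | GoodSample H D g γ {f | ∃ v ∈ vs, f = flipLevel B hs v} S}
          {S | GoodSample H D g γ {f | ∃ v' ∈ v :: vs, f = flipLevel B hs v'} S}
          (c := 1) (fun S' hS' => by
            have h3 := GoodSample.append hS hS'
            rw [EQProg.prob, if_pos]
            refine ⟨h3.1, fun h hh hcon f hf => h3.2 h hh hcon f ?_⟩
            obtain ⟨v', hv', rfl⟩ := hf
            rcases List.mem_cons.1 hv' with rfl | hv'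
            · exact Or.inl rfl
            · exact Or.inr ⟨v', hv', rfl⟩)
        rw [mul_one] at h2
        exact ih.trans h2)
    refine le_trans ?_ h1
    gcongr
    exact hc _ (measurable_flipLevel hhs v)

/-- The round consists of one batch for the majority and one for each odd level. The joint sample is
consistent with `g`, which is what obliges `FC` to return a consistent member of `H`; that
hypothesis inherits the guarantees of all batches. -/
theorem le_prob_step {H : Set (X → ℤˣ)} {D : Measure X} {g : X → ℤˣ} (hg : g ∈ H) {γ : ℝ} {m : ℕ}
    {c : ℝ≥0∞} (hc : ∀ f : X → ℤˣ, Measurable f →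
      c ≤ (sampleEQ f m).prob D g {S | GoodSample H D g γ {f} S})
    {FC : List (X × ℤˣ) → X → ℤˣ} (hFC : IsFindConsistent H FC)
    {B : ℕ} {hs : List (X → ℤˣ)} (hhs : ∀ h ∈ hs, Measurable h) :
    c ^ ((oddLevels B).length + 1) ≤ (step FC B m hs).prob D g
      {hs' | ∃ h ∈ H, GoodNext D g γ B hs h ∧ hs' = h :: hs} := by
  set E : Set (List (X → ℤˣ)) := {hs' | ∃ h ∈ H, GoodNext D g γ B hs h ∧ hs' = h :: hs}
  rw [pow_succ']
  have h1 := EQProg.prob_bind_ge D g (sampleEQ (maj B hs) m)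
    (fun S => (sampleFlipped B m hs (oddLevels B)).bind fun S' =>
      EQProg.ret (FC (S ++ S') :: hs))
    {S | GoodSample H D g γ {maj B hs} S} E
    (c := c ^ (oddLevels B).length) (fun S hS => by
      have h2 := EQProg.prob_bind_ge D g (sampleFlipped B m hs (oddLevels B))
        (fun S' => EQProg.ret (FC (S ++ S') :: hs))
        {S | GoodSample H D g γ {f | ∃ v ∈ oddLevels B, f = flipLevel B hs v} S} E
        (c := 1) (fun S' hS' => by
          have h3 := GoodSample.append hS hS'
          rw [EQProg.prob, if_pos]
          obtain ⟨h4, h5⟩ := hFC (S ++ S') ⟨g, hg, h3.1⟩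
          exact ⟨_, h4, ⟨h3.2 _ h4 h5 _ (Or.inl rfl),
            fun v hv => h3.2 _ h4 h5 _ (Or.inr ⟨v, hv, rfl⟩)⟩, rfl⟩)
      rw [mul_one] at h2
      exact (le_prob_sampleFlipped hc hhs _).trans h2)
  refine le_trans ?_ h1
  gcongr
  exact hc _ (measurable_maj hhs)

/-- An invariant that is preserved by good hypotheses holds after all rounds with high
probability. -/
theorem le_prob_steps {H : Set (X → ℤˣ)} (hH : IsMeasurableClass H) {D : Measure X} {g : X → ℤˣ}
    (hg : g ∈ H) {γ : ℝ} {m : ℕ}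
    {c : ℝ≥0∞} (hc : ∀ f : X → ℤˣ, Measurable f →
      c ≤ (sampleEQ f m).prob D g {S | GoodSample H D g γ {f} S})
    {FC : List (X × ℤˣ) → X → ℤˣ} (hFC : IsFindConsistent H FC) {B : ℕ}
    (I : ℕ → List (X → ℤˣ) → Prop)
    (hI : ∀ n hs, (∀ h ∈ hs, h ∈ H) → ∀ h ∈ H, GoodNext D g γ B hs h → I (n + 1) hs →
      I n (h :: hs)) (n : ℕ) {hs : List (X → ℤˣ)} (hhs : ∀ h ∈ hs, h ∈ H) (h0 : I n hs) :
    c ^ (((oddLevels B).length + 1) * n) ≤ (steps FC B m n hs).prob D g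
      {hs' | (∀ h ∈ hs', h ∈ H) ∧ I 0 hs'} := by
  induction n generalizing hs with
  | zero =>
    change _ ≤ (EQProg.ret hs).prob D g _
    rw [EQProg.prob, if_pos ⟨hhs, h0⟩]
    simp
  | succ n ih =>
    have h1 := EQProg.prob_bind_ge D g (step FC B m hs) (fun hs' => steps FC B m n hs')
      {hs' | ∃ h ∈ H, GoodNext D g γ B hs h ∧ hs' = h :: hs} {hs' | (∀ h ∈ hs', h ∈ H) ∧ I 0 hs'}
      (c := c ^ (((oddLevels B).length + 1) * n)) (fun hs' hhs' => by
        obtain ⟨h, hh, hgood, rfl⟩ := hhs'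
        refine ih (fun k hk => ?_) (hI n hs hhs h hh hgood h0)
        rcases List.mem_cons.1 hk with rfl | hk
        · exact hh
        · exact hhs k hk)
    refine le_trans ?_ h1
    rw [Nat.mul_succ, add_comm, pow_add]
    gcongr
    exact le_prob_step hg hc hFC fun h hh => hH.measurable h (hhs h hh)

/-! ### The potential -/

/-- The weight of the margin `s`, for the clipping level `B = 2 * K - 1`. -/
noncomputable def weight (K : ℕ) (s : ℤ) : ℝ :=
  if 0 < s then 4 ^ (K - 1 - (s / 2).toNat) else 4 ^ K * (1 + ((-s / 2 : ℤ) : ℝ) / (2 * K - 1))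

theorem weight_pos_odd {K j : ℕ} : weight K (2 * j + 1) = 4 ^ (K - 1 - j) := by
  rw [weight, if_pos (by omega)]
  congr 2
  omega

theorem weight_neg_odd {K j : ℕ} :
    weight K (-(2 * j + 1)) = 4 ^ K * (1 + (j : ℝ) / (2 * K - 1)) := by
  rw [weight, if_neg (by omega)]
  have : (- -(2 * (j : ℤ) + 1)) / 2 = j := by omega
  rw [this]
  simp

/-- Moving up divides a positive weight by 4, as does crossing from -1 to 1. Among negative levels
the weight is affine, and the claim reduces to `j ≤ B`. Only at the clipped top level, of weight 1,
is there no decrease; the summand 1 covers it. -/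
theorem weight_succ_le {K : ℕ} (hK : 1 ≤ K) {s : ℤ} (hs : Odd s) (hs1 : -(2 * (K : ℤ) - 1) ≤ s)
    (hs2 : s ≤ 2 * (K : ℤ) - 1) :
    weight K (clip (2 * K - 1) (s + 2)) ≤ (1 - 1 / (2 * (2 * K - 1))) * weight K s + 1 := by
  have hB : (1 : ℝ) ≤ 2 * K - 1 := by
    have : (1 : ℝ) ≤ K := by exact_mod_cast hK
    linarith
  have hη : 1 / (2 * (2 * (K : ℝ) - 1)) ≤ 1 / 2 :=
    one_div_le_one_div_of_le (by norm_num) (by linarith)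
  obtain ⟨k, rfl⟩ := hs
  rcases le_or_gt 0 k with hk | hk
  · obtain ⟨j, rfl⟩ := Int.eq_ofNat_of_zero_le hk
    rw [weight_pos_odd]
    have h4 : (0 : ℝ) < 4 ^ (K - 1 - j) := by positivity
    by_cases hj : j + 1 < K
    · have h1 : clip (2 * K - 1) (2 * (j : ℤ) + 1 + 2) = 2 * ((j + 1 : ℕ) : ℤ) + 1 := by
        rw [clip]; omega
      rw [h1, weight_pos_odd]
      have h2 : (4 : ℝ) ^ (K - 1 - j) = 4 * 4 ^ (K - 1 - (j + 1)) := by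
        rw [← pow_succ']; congr 1; omega
      rw [h2] at h4 ⊢
      nlinarith
    · have h1 : clip (2 * K - 1) (2 * (j : ℤ) + 1 + 2) = 2 * ((K - 1 : ℕ) : ℤ) + 1 := by
        rw [clip]; omega
      rw [h1, weight_pos_odd, Nat.sub_self]
      nlinarith
  · obtain ⟨j, hj⟩ := Int.eq_ofNat_of_zero_le (show 0 ≤ -k - 1 by omega)
    obtain rfl : k = -(j : ℤ) - 1 := by omega
    have h0 : 2 * (-(j : ℤ) - 1) + 1 = -(2 * j + 1) := by ring
    rw [h0, weight_neg_odd]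
    have hjK : (j : ℝ) ≤ 2 * K - 1 := by
      have : ((j : ℤ) : ℝ) ≤ ((2 * (K : ℤ) - 1 : ℤ) : ℝ) := by
        exact_mod_cast (by omega : (j : ℤ) ≤ 2 * K - 1)
      push_cast at this
      exact this
    have h4 : (0 : ℝ) < 4 ^ K := by positivity
    set b : ℝ := 2 * K - 1
    rcases Nat.eq_zero_or_pos j with rfl | hj0
    · have h1 : clip (2 * K - 1) (-(2 * ((0 : ℕ) : ℤ) + 1) + 2) = 2 * ((0 : ℕ) : ℤ) + 1 := by
        rw [clip]; omega
      rw [h1, weight_pos_odd]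
      have h2 : (4 : ℝ) ^ K = 4 * 4 ^ (K - 1 - 0) := by
        rw [← pow_succ']; congr 1; omega
      rw [h2] at h4 ⊢
      simp only [Nat.cast_zero, zero_div, add_zero, mul_one]
      nlinarith
    · obtain ⟨i, rfl⟩ := Nat.exists_eq_add_of_le' hj0
      have h1 : clip (2 * K - 1) (-(2 * ((i + 1 : ℕ) : ℤ) + 1) + 2) = -(2 * (i : ℤ) + 1) := by
        rw [clip]; omega
      rw [h1, weight_neg_odd]
      have h5 : 1 + (i : ℝ) / b ≤ (1 - 1 / (2 * b)) * (1 + ((i + 1 : ℕ) : ℝ) / b) := by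
        -- The slack in closed form; its sign is that of `B - (i + 1)`.
        have h6 : (1 - 1 / (2 * b)) * (1 + ((i + 1 : ℕ) : ℝ) / b) - (1 + (i : ℝ) / b) =
            (b - ((i + 1 : ℕ) : ℝ)) / (2 * b ^ 2) := by
          have : b ≠ 0 := by positivity
          push_cast
          field_simp
          ring
        have h7 : 0 ≤ (b - ((i + 1 : ℕ) : ℝ)) / (2 * b ^ 2) :=
          div_nonneg (by linarith) (by positivity)
        linarith
      have := mul_le_mul_of_nonneg_left h5 h4.le
      linarith

/-- The extra weight that an error may cause. -/
noncomputable def errWeight (K : ℕ) (s : ℤ) : ℝ := if 0 < s then 4 * weight K s else 2 * 4 ^ K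

theorem weight_nonneg {K : ℕ} (hK : 1 ≤ K) (s : ℤ) : 0 ≤ weight K s := by
  have hB : (1 : ℝ) ≤ K := by exact_mod_cast hK
  rw [weight]
  split_ifs with h
  · positivity
  · have : (0 : ℝ) ≤ ((-s / 2 : ℤ) : ℝ) := by exact_mod_cast (by omega : 0 ≤ -s / 2)
    have : 0 ≤ ((-s / 2 : ℤ) : ℝ) / (2 * K - 1) := div_nonneg this (by linarith)
    positivity

/-- Neighbouring positive levels differ by a factor of 4, and so do the levels 1 and -1. All
negative levels have weight at most `2 * 4^K`, which is why the negative side can be charged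
uniformly. -/
theorem weight_pred_le {K : ℕ} (hK : 1 ≤ K) {s : ℤ} (hs : Odd s) (hs1 : -(2 * (K : ℤ) - 1) ≤ s)
    (hs2 : s ≤ 2 * (K : ℤ) - 1) :
    weight K (clip (2 * K - 1) (s - 2)) ≤ errWeight K s := by
  have hB : (1 : ℝ) ≤ 2 * K - 1 := by
    have : (1 : ℝ) ≤ K := by exact_mod_cast hK
    linarith
  obtain ⟨k, rfl⟩ := hs
  rcases le_or_gt 0 k with hk | hk
  · obtain ⟨j, rfl⟩ := Int.eq_ofNat_of_zero_le hk
    rw [errWeight, if_pos (by omega), weight_pos_odd]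
    rcases Nat.eq_zero_or_pos j with rfl | hj0
    · have h1 : clip (2 * K - 1) (2 * ((0 : ℕ) : ℤ) + 1 - 2) = -(2 * ((0 : ℕ) : ℤ) + 1) := by
        rw [clip]; omega
      rw [h1, weight_neg_odd]
      have h2 : (4 : ℝ) ^ K = 4 * 4 ^ (K - 1 - 0) := by
        rw [← pow_succ']; congr 1; omega
      simp [h2]
    · obtain ⟨i, rfl⟩ := Nat.exists_eq_add_of_le' hj0
      have h1 : clip (2 * K - 1) (2 * ((i + 1 : ℕ) : ℤ) + 1 - 2) = 2 * (i : ℤ) + 1 := by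
        rw [clip]; omega
      rw [h1, weight_pos_odd]
      have h2 : (4 : ℝ) ^ (K - 1 - i) = 4 * 4 ^ (K - 1 - (i + 1)) := by
        rw [← pow_succ']; congr 1; omega
      exact h2.le
  · rw [errWeight, if_neg (by omega)]
    obtain ⟨j, hj, hjK⟩ : ∃ j : ℕ, clip (2 * K - 1) (2 * k + 1 - 2) = -(2 * (j : ℤ) + 1) ∧
        j ≤ K - 1 := by
      by_cases h : -(K : ℤ) = k
      · exact ⟨K - 1, by rw [clip]; omega, le_rfl⟩
      · exact ⟨(-k).toNat, by rw [clip]; omega, by omega⟩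
    rw [hj, weight_neg_odd]
    have h1 : (j : ℝ) / (2 * K - 1) ≤ 1 := by
      rw [div_le_one (by linarith)]
      have : (j : ℝ) + 1 ≤ K := by exact_mod_cast (by omega : j + 1 ≤ K)
      have : (1 : ℝ) ≤ K := by exact_mod_cast hK
      linarith
    have h4 : (0 : ℝ) < 4 ^ K := by positivity
    nlinarith

theorem weight_le {K : ℕ} (hK : 1 ≤ K) {s : ℤ} (hs1 : -(2 * (K : ℤ) - 1) ≤ s) :
    weight K s ≤ 2 * 4 ^ K := by
  rw [weight]
  have h4 : (0 : ℝ) < 4 ^ K := by positivity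
  have hB : (1 : ℝ) ≤ K := by exact_mod_cast hK
  split_ifs with h
  · have : (4 : ℝ) ^ (K - 1 - (s / 2).toNat) ≤ 4 ^ K :=
      pow_le_pow_right₀ (by norm_num) (by omega)
    linarith
  · have h1 : ((-s / 2 : ℤ) : ℝ) / (2 * K - 1) ≤ 1 := by
      rw [div_le_one (by linarith)]
      have : ((-s / 2 : ℤ) : ℝ) ≤ ((K : ℤ) : ℝ) := by exact_mod_cast (by omega : -s / 2 ≤ (K : ℤ))
      push_cast at this ⊢
      linarith
    nlinarith

/-! ### Margins -/

/-- Steps of size 2 and clipping at an odd level preserve oddness. Hence the vote never vanishes,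
and the tie rule in `maj` plays no role. -/
theorem vote_odd_and_bounds {X : Type u} {K : ℕ} (hK : 1 ≤ K) {hs : List (X → ℤˣ)} (hne : hs ≠ [])
    (x : X) : Odd (vote (2 * K - 1) hs x) ∧ -(2 * (K : ℤ) - 1) ≤ vote (2 * K - 1) hs x ∧
      vote (2 * K - 1) hs x ≤ 2 * (K : ℤ) - 1 := by
  induction hs with
  | nil => exact absurd rfl hne
  | cons h hs ih =>
    cases hs with
    | nil =>
      rw [vote]
      rcases Int.units_eq_one_or (h x) with h1 | h1 <;> rw [h1]
      · exact ⟨odd_one, by push_cast; omega, by push_cast; omega⟩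
      · exact ⟨by decide, by push_cast; omega, by push_cast; omega⟩
    | cons h' hs =>
      obtain ⟨⟨k, hk⟩, h2, h3⟩ := ih (by simp)
      rw [vote, hk, clip]
      rw [hk] at h2 h3
      rw [Int.odd_iff]
      rcases Int.units_eq_one_or (h x) with h1 | h1 <;> rw [h1] <;> push_cast <;> omega

/-- The vote, signed by its correctness. -/
def margin {X : Type u} (B : ℕ) (g : X → ℤˣ) (hs : List (X → ℤˣ)) (x : X) : ℤ :=
  g x * vote B hs x

theorem margin_odd_and_bounds {X : Type u} {K : ℕ} (hK : 1 ≤ K) (g : X → ℤˣ)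
    {hs : List (X → ℤˣ)} (hne : hs ≠ []) (x : X) :
    Odd (margin (2 * K - 1) g hs x) ∧ -(2 * (K : ℤ) - 1) ≤ margin (2 * K - 1) g hs x ∧
      margin (2 * K - 1) g hs x ≤ 2 * (K : ℤ) - 1 := by
  obtain ⟨h1, h2, h3⟩ := vote_odd_and_bounds hK hne x
  rw [margin]
  rcases Int.units_eq_one_or (g x) with h | h <;> rw [h]
  · push_cast
    rw [one_mul]
    exact ⟨h1, h2, h3⟩
  · push_cast
    rw [neg_one_mul]
    exact ⟨h1.neg, by omega, by omega⟩

theorem margin_cons {X : Type u} {B : ℕ} (g h : X → ℤˣ) {hs : List (X → ℤˣ)} (hne : hs ≠ [])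
    (x : X) : margin B g (h :: hs) x =
      clip B (margin B g hs x + if h x ≠ g x then -2 else 2) := by
  obtain ⟨h', hs, rfl⟩ := List.exists_cons_of_ne_nil hne
  rw [margin, margin, vote, clip, clip]
  rcases Int.units_eq_one_or (g x) with h1 | h1 <;> rcases Int.units_eq_one_or (h x) with h2 | h2 <;>
    rw [h1, h2] <;> simp <;> omega

theorem maj_ne_iff {X : Type u} {K : ℕ} (hK : 1 ≤ K) (g : X → ℤˣ)
    {hs : List (X → ℤˣ)} (hne : hs ≠ []) (x : X) :
    maj (2 * K - 1) hs x ≠ g x ↔ margin (2 * K - 1) g hs x < 0 := by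
  obtain ⟨⟨k, hk⟩, -⟩ := vote_odd_and_bounds hK hne x
  rw [margin, maj, hk]
  rcases Int.units_eq_one_or (g x) with h | h <;> rw [h] <;> split_ifs with h1 <;> simp <;> omega

/-- This is the purpose of the flipped queries: flipping at `±v` turns the correctly classified
level `v` into errors and removes level `-v` from the errors, so an error bound relative to this
region controls level `v`. -/
theorem flipLevel_ne_iff {X : Type u} {K : ℕ} (hK : 1 ≤ K) (g : X → ℤˣ)
    {hs : List (X → ℤˣ)} (hne : hs ≠ []) {v : ℕ} (hv : 0 < v) (x : X) :
    flipLevel (2 * K - 1) hs v x ≠ g x ↔ margin (2 * K - 1) g hs x = v ∨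
      margin (2 * K - 1) g hs x < 0 ∧ margin (2 * K - 1) g hs x ≠ -v := by
  have h1 := maj_ne_iff hK g hne x
  have h2 : (vote (2 * K - 1) hs x = v ∨ vote (2 * K - 1) hs x = -v) ↔
      (margin (2 * K - 1) g hs x = v ∨ margin (2 * K - 1) g hs x = -v) := by
    rw [margin]
    rcases Int.units_eq_one_or (g x) with h | h <;> rw [h] <;> push_cast <;> omega
  rw [flipLevel, flipOn, Set.mem_ofPred_eq, h2]
  split_ifs with h3
  · have h4 : (-maj (2 * K - 1) hs x ≠ g x) ↔ ¬ (maj (2 * K - 1) hs x ≠ g x) := by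
      rcases Int.units_eq_one_or (g x) with h | h <;>
      rcases Int.units_eq_one_or (maj (2 * K - 1) hs x) with h' | h' <;> rw [h, h'] <;> decide
    rw [h4, h1]
    omega
  · rw [h1]
    omega

/-! ### Decrease of the potential -/

/-- The expected weight of the margin. -/
noncomputable def potential (D : Measure X) (g : X → ℤˣ) (K : ℕ) (hs : List (X → ℤˣ)) : ℝ :=
  ∫ x, weight K (margin (2 * K - 1) g hs x) ∂D

theorem measurable_margin {B : ℕ} {g : X → ℤˣ} (hg : Measurable g) {hs : List (X → ℤˣ)}
    (hhs : ∀ h ∈ hs, Measurable h) : Measurable (margin B g hs) := by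
  have hval : Measurable (Units.val : ℤˣ → ℤ) := fun s _ => measurableSet_units _
  exact (hval.comp hg).mul (measurable_vote hhs)

theorem integrable_weight_margin (D : Measure X) [IsProbabilityMeasure D] {K : ℕ} (hK : 1 ≤ K)
    {g : X → ℤˣ} (hg : Measurable g) {hs : List (X → ℤˣ)} (hne : hs ≠ [])
    (hhs : ∀ h ∈ hs, Measurable h) :
    Integrable (fun x => weight K (margin (2 * K - 1) g hs x)) D := by
  refine Integrable.of_bound (C := 2 * 4 ^ K) ?_ (Filter.Eventually.of_forall fun x => ?_)
  · exact ((Measurable.of_discrete (f := weight K)).comp (measurable_margin hg hhs)).aestronglyMeasurable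
  · rw [Real.norm_of_nonneg (weight_nonneg hK _)]
    exact weight_le hK (margin_odd_and_bounds hK g hne x).2.1

/-- The levels are disjoint, so this is a pointwise lower bound on the weight, exact on positive
margins and dropping the affine part on negative ones. It turns level masses into potential. -/
theorem sum_levels_le_potential (D : Measure X) [IsProbabilityMeasure D] {K : ℕ} (hK : 1 ≤ K)
    {g : X → ℤˣ} (hg : Measurable g) {hs : List (X → ℤˣ)} (hne : hs ≠ [])
    (hhs : ∀ h ∈ hs, Measurable h) :
    ∑ j ∈ Finset.range K, 4 ^ (K - 1 - j) * D.real {x | margin (2 * K - 1) g hs x = 2 * j + 1} +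
      4 ^ K * D.real {x | margin (2 * K - 1) g hs x < 0} ≤ potential D g K hs := by
  set s := margin (2 * K - 1) g hs
  have hsm : Measurable s := measurable_margin hg hhs
  have hm1 : ∀ j : ℕ, MeasurableSet {x | s x = 2 * j + 1} := fun j =>
    hsm (MeasurableSet.of_discrete (s := {v : ℤ | v = 2 * j + 1}))
  have hm2 : MeasurableSet {x | s x < 0} := hsm (MeasurableSet.of_discrete (s := {v : ℤ | v < 0}))
  have hi1 : ∀ j : ℕ, Integrable ({x | s x = 2 * j + 1}.indicator fun _ => (4 : ℝ) ^ (K - 1 - j)) D :=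
    fun j => (integrable_const _).indicator (hm1 j)
  have hi2 : Integrable ({x | s x < 0}.indicator fun _ => (4 : ℝ) ^ K) D :=
    (integrable_const _).indicator hm2
  have h1 : ∑ j ∈ Finset.range K, 4 ^ (K - 1 - j) * D.real {x | s x = 2 * j + 1} +
      4 ^ K * D.real {x | s x < 0} = ∫ x, (∑ j ∈ Finset.range K,
        {x | s x = 2 * j + 1}.indicator (fun _ => (4 : ℝ) ^ (K - 1 - j)) x +
        {x | s x < 0}.indicator (fun _ => (4 : ℝ) ^ K) x) ∂D := by
    rw [integral_add (integrable_finsetSum _ fun j _ => hi1 j) hi2,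
      integral_finsetSum _ fun j _ => hi1 j, integral_indicator_const _ hm2]
    congr 1
    · refine Finset.sum_congr rfl fun j _ => ?_
      rw [integral_indicator_const _ (hm1 j), smul_eq_mul, mul_comm]
    · rw [smul_eq_mul, mul_comm]
  rw [h1]
  refine integral_mono ((integrable_finsetSum _ fun j _ => hi1 j).add hi2)
    (integrable_weight_margin D hK hg hne hhs) fun x => ?_
  obtain ⟨⟨k, hk⟩, hx1, hx2⟩ := margin_odd_and_bounds hK g hne x
  change s x = _ at hk
  change _ ≤ s x at hx1
  change s x ≤ _ at hx2
  change _ ≤ weight K (s x)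
  have hzero : ∀ j : ℕ, s x ≠ 2 * j + 1 →
      {x | s x = 2 * j + 1}.indicator (fun _ => (4 : ℝ) ^ (K - 1 - j)) x = 0 :=
    fun j hj => Set.indicator_of_notMem (s := {x | s x = 2 * (j : ℤ) + 1}) hj _
  rcases le_or_gt 0 k with hk0 | hk0
  · obtain ⟨i, rfl⟩ := Int.eq_ofNat_of_zero_le hk0
    rw [Set.indicator_of_notMem (s := {x | s x < 0}) (by
        simp only [Set.mem_ofPred_eq]; omega), add_zero,
      Finset.sum_eq_single i (fun j _ hj => hzero j (by omega))
        (fun hi => absurd (Finset.mem_range.2 (by omega)) hi),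
      Set.indicator_of_mem (by simpa using hk), hk, weight_pos_odd]
  · rw [Set.indicator_of_mem (s := {x | s x < 0}) (by simp only [Set.mem_ofPred_eq]; omega),
      Finset.sum_eq_zero fun j _ => hzero j (by omega), zero_add]
    obtain ⟨j, hj⟩ := Int.eq_ofNat_of_zero_le (show 0 ≤ -k - 1 by omega)
    have h0 : s x = -(2 * j + 1) := by omega
    rw [h0, weight_neg_odd]
    have hB : (1 : ℝ) ≤ K := by exact_mod_cast hK
    have : 0 ≤ (j : ℝ) / (2 * K - 1) := div_nonneg (by positivity) (by linarith)
    exact le_mul_of_one_le_right (by positivity) (by linarith)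

/-- Every positive level is charged the negative mass once; the geometric weights keep the total
charge within `4/3 * 4^K`, with no factor `K`. -/
theorem geom_sum_four_le (K : ℕ) :
    3 * ∑ j ∈ Finset.range K, (4 : ℝ) ^ (K - j) ≤ 4 * 4 ^ K := by
  induction K with
  | zero => simp
  | succ K ih =>
    rw [Finset.sum_range_succ']
    simp only [Nat.add_sub_add_right, Nat.sub_zero, pow_succ (4 : ℝ) K]
    linarith

theorem mem_oddLevels {B v : ℕ} : v ∈ oddLevels B ↔ v ≤ B ∧ v % 2 = 1 := by
  simp [oddLevels]

/-- The error of a good hypothesis on a positive margin level. -/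
theorem measureReal_err_level_le (D : Measure X) [IsProbabilityMeasure D] {K : ℕ} (hK : 1 ≤ K)
    {g h : X → ℤˣ} {hs : List (X → ℤˣ)} (hne : hs ≠ []) {γ : ℝ} (hγ : 0 ≤ γ)
    (hgood : GoodNext D g γ (2 * K - 1) hs h) {j : ℕ} (hj : j < K) :
    D.real ({x | margin (2 * K - 1) g hs x = 2 * j + 1} ∩ {x | h x ≠ g x}) ≤
      γ * (D.real {x | margin (2 * K - 1) g hs x = 2 * j + 1} +
        D.real {x | margin (2 * K - 1) g hs x < 0}) := by
  have h1 := hgood.2 (2 * j + 1) (mem_oddLevels.2 ⟨by omega, by omega⟩)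
  have h2 := flipLevel_ne_iff hK g hne (v := 2 * j + 1) (by omega)
  calc _ ≤ D.real ({x | flipLevel (2 * K - 1) hs (2 * j + 1) x ≠ g x} ∩ {x | h x ≠ g x}) := by
        refine measureReal_mono (Set.inter_subset_inter_left _ fun x hx => ?_)
        exact (h2 x).2 (Or.inl (by push_cast; exact hx))
    _ ≤ γ * D.real {x | flipLevel (2 * K - 1) hs (2 * j + 1) x ≠ g x} := h1
    _ ≤ γ * D.real ({x | margin (2 * K - 1) g hs x = 2 * j + 1} ∪
          {x | margin (2 * K - 1) g hs x < 0}) := by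
        refine mul_le_mul_of_nonneg_left (measureReal_mono fun x hx => ?_) hγ
        rcases (h2 x).1 hx with h3 | h3
        · exact Or.inl (by push_cast at h3; exact h3)
        · exact Or.inr h3.1
    _ ≤ _ := mul_le_mul_of_nonneg_left (measureReal_union_le _ _) hγ

/-- With `γ = 1/(16B)`, correct votes alone would contract by `1 - 8γ`. Errors add at most `4γ`
times the positive part of the potential and `(4/3 + 2)γ * 4^K` times the negative mass, together at
most `4γ` times the potential. The net factor is `1 - 4γ`. -/
theorem potential_cons_le (D : Measure X) [IsProbabilityMeasure D] {K : ℕ} (hK : 1 ≤ K)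
    {g h : X → ℤˣ} (hg : Measurable g) (hh : Measurable h) {hs : List (X → ℤˣ)} (hne : hs ≠ [])
    (hhs : ∀ h ∈ hs, Measurable h)
    (hgood : GoodNext D g (1 / (16 * (2 * K - 1))) (2 * K - 1) hs h) :
    potential D g K (h :: hs) ≤ (1 - 1 / (4 * (2 * K - 1))) * potential D g K hs + 1 := by
  have hb : (1 : ℝ) ≤ 2 * K - 1 := by
    have : (1 : ℝ) ≤ K := by exact_mod_cast hK
    linarith
  have hγ : (0 : ℝ) ≤ 1 / (16 * (2 * K - 1)) := by positivity
  set γ : ℝ := 1 / (16 * (2 * K - 1))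
  have hγ1 : 1 / (4 * (2 * (K : ℝ) - 1)) = 4 * γ := by simp only [γ]; field_simp; norm_num
  have hγ2 : 1 / (2 * (2 * (K : ℝ) - 1)) = 8 * γ := by simp only [γ]; field_simp; norm_num
  have hlevels := sum_levels_le_potential D hK hg hne hhs
  have hlevel := fun j (hj : j ∈ Finset.range K) =>
    measureReal_err_level_le D hK hne hγ hgood (Finset.mem_range.1 hj)
  have hmajor : D.real ({x | margin (2 * K - 1) g hs x < 0} ∩ {x | h x ≠ g x}) ≤
      γ * D.real {x | margin (2 * K - 1) g hs x < 0} := by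
    have := hgood.1
    simpa only [SmallErr, maj_ne_iff hK g hne] using this
  set s := margin (2 * K - 1) g hs
  have hE : MeasurableSet {x | h x ≠ g x} := measurableSet_ne hh hg
  have hsm : Measurable s := measurable_margin hg hhs
  have hm1 : ∀ j : ℕ, MeasurableSet ({x | s x = 2 * j + 1} ∩ {x | h x ≠ g x}) := fun j =>
    (hsm (MeasurableSet.of_discrete (s := {v : ℤ | v = 2 * j + 1}))).inter hE
  have hm2 : MeasurableSet ({x | s x < 0} ∩ {x | h x ≠ g x}) :=
    (hsm (MeasurableSet.of_discrete (s := {v : ℤ | v < 0}))).inter hE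
  have hi1 : ∀ j : ℕ, Integrable (({x | s x = 2 * j + 1} ∩ {x | h x ≠ g x}).indicator
      fun _ => (4 : ℝ) ^ (K - j)) D := fun j => (integrable_const _).indicator (hm1 j)
  have hi2 : Integrable (({x | s x < 0} ∩ {x | h x ≠ g x}).indicator fun _ => 2 * (4 : ℝ) ^ K) D :=
    (integrable_const _).indicator hm2
  have hi3 : Integrable (fun x => (1 - 8 * γ) * weight K (s x) + 1) D :=
    ((integrable_weight_margin D hK hg hne hhs).const_mul _).add (integrable_const _)
  have hi4 : Integrable (fun x => ∑ j ∈ Finset.range K,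
        ({x | s x = 2 * j + 1} ∩ {x | h x ≠ g x}).indicator (fun _ => (4 : ℝ) ^ (K - j)) x +
        ({x | s x < 0} ∩ {x | h x ≠ g x}).indicator (fun _ => 2 * (4 : ℝ) ^ K) x) D :=
    (integrable_finsetSum _ fun j _ => hi1 j).add hi2
  -- Everywhere the contraction bound for a correct vote is kept, being nonnegative; where `h` errs,
  -- the cost `errWeight` is added on top.
  have hpt : ∀ x, weight K (margin (2 * K - 1) g (h :: hs) x) ≤
      ((1 - 8 * γ) * weight K (s x) + 1) + (∑ j ∈ Finset.range K,
        ({x | s x = 2 * j + 1} ∩ {x | h x ≠ g x}).indicator (fun _ => (4 : ℝ) ^ (K - j)) x +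
        ({x | s x < 0} ∩ {x | h x ≠ g x}).indicator (fun _ => 2 * (4 : ℝ) ^ K) x) := by
    intro x
    obtain ⟨hx0, hx1, hx2⟩ := margin_odd_and_bounds hK g hne x
    rw [margin_cons g h hne]
    change Odd (s x) at hx0
    change _ ≤ s x at hx1
    change s x ≤ _ at hx2
    change weight K (clip _ (s x + _)) ≤ _
    have hn1 : ∀ j ∈ Finset.range K, 0 ≤ ({x | s x = 2 * j + 1} ∩ {x | h x ≠ g x}).indicator
        (fun _ => (4 : ℝ) ^ (K - j)) x := fun j _ =>
      Set.indicator_nonneg (fun _ _ => by positivity) _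
    have hn2 : 0 ≤ ({x | s x < 0} ∩ {x | h x ≠ g x}).indicator (fun _ => 2 * (4 : ℝ) ^ K) x :=
      Set.indicator_nonneg (fun _ _ => by positivity) _
    have hn3 := Finset.sum_nonneg hn1
    have hsucc := weight_succ_le hK hx0 hx1 hx2
    rw [hγ2] at hsucc
    by_cases hx : h x ≠ g x
    · rw [if_pos hx, ← sub_eq_add_neg]
      have hpred := weight_pred_le hK hx0 hx1 hx2
      have hn4 : 0 ≤ (1 - 8 * γ) * weight K (s x) + 1 :=
        (weight_nonneg hK _).trans hsucc
      suffices errWeight K (s x) ≤ ∑ j ∈ Finset.range K,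
          ({x | s x = 2 * j + 1} ∩ {x | h x ≠ g x}).indicator (fun _ => (4 : ℝ) ^ (K - j)) x +
          ({x | s x < 0} ∩ {x | h x ≠ g x}).indicator (fun _ => 2 * (4 : ℝ) ^ K) x by linarith
      obtain ⟨k, hk⟩ := hx0
      rcases le_or_gt 0 k with hk0 | hk0
      · obtain ⟨i, rfl⟩ := Int.eq_ofNat_of_zero_le hk0
        have h1 := Finset.single_le_sum hn1 (Finset.mem_range.2 (show i < K by omega))
        rw [Set.indicator_of_mem (by exact ⟨hk, hx⟩)] at h1
        rw [errWeight, if_pos (by omega), hk, weight_pos_odd]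
        have h2 : (4 : ℝ) ^ (K - i) = 4 * 4 ^ (K - 1 - i) := by
          rw [← pow_succ']; congr 1; omega
        linarith
      · have hneg : s x < 0 := by omega
        rw [errWeight, if_neg (by omega), Set.indicator_of_mem (s := {x | s x < 0} ∩ _)
          ⟨hneg, hx⟩]
        linarith
    · rw [if_neg hx]
      linarith
  have hint := integral_mono (integrable_weight_margin D hK hg (List.cons_ne_nil h hs)
    (by simpa using ⟨hh, hhs⟩)) (hi3.add hi4) hpt
  simp only [Pi.add_apply] at hint
  rw [integral_add hi3 hi4,
    integral_add ((integrable_weight_margin D hK hg hne hhs).const_mul _) (integrable_const _),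
    integral_const_mul, integral_add (integrable_finsetSum _ fun j _ => hi1 j) hi2,
    integral_finsetSum _ fun j _ => hi1 j, integral_indicator_const _ hm2] at hint
  simp only [integral_indicator_const _ (hm1 _), smul_eq_mul, integral_const, probReal_univ,
    mul_one] at hint
  change potential D g K (h :: hs) ≤ (1 - 8 * γ) * potential D g K hs + 1 + _ at hint
  have hsum : ∑ j ∈ Finset.range K,
      D.real ({x | s x = 2 * j + 1} ∩ {x | h x ≠ g x}) * 4 ^ (K - j) ≤
      γ * (4 * ∑ j ∈ Finset.range K, 4 ^ (K - 1 - j) * D.real {x | s x = 2 * j + 1} +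
        4 / 3 * 4 ^ K * D.real {x | s x < 0}) := by
    calc _ ≤ ∑ j ∈ Finset.range K, γ * (D.real {x | s x = 2 * j + 1} + D.real {x | s x < 0}) *
            4 ^ (K - j) := Finset.sum_le_sum fun j hj =>
          mul_le_mul_of_nonneg_right (hlevel j hj) (by positivity)
      _ = γ * (4 * ∑ j ∈ Finset.range K, 4 ^ (K - 1 - j) * D.real {x | s x = 2 * j + 1} +
            (∑ j ∈ Finset.range K, (4 : ℝ) ^ (K - j)) * D.real {x | s x < 0}) := by
          rw [Finset.mul_sum, Finset.sum_mul, ← Finset.sum_add_distrib, Finset.mul_sum]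
          refine Finset.sum_congr rfl fun j hj => ?_
          have h2 : (4 : ℝ) ^ (K - j) = 4 * 4 ^ (K - 1 - j) := by
            have := Finset.mem_range.1 hj
            rw [← pow_succ']; congr 1; omega
          rw [h2]; ring
      _ ≤ _ := by
          refine mul_le_mul_of_nonneg_left ?_ hγ
          have := geom_sum_four_le K
          have := mul_le_mul_of_nonneg_right this (measureReal_nonneg (μ := D) (s := {x | s x < 0}))
          linarith
  rw [hγ1]
  have h5 := mul_le_mul_of_nonneg_left hlevels hγ
  have h6 : (0 : ℝ) < 4 ^ K := by positivity
  have h7 := mul_le_mul_of_nonneg_right hmajor h6.le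
  have h8 : 0 ≤ γ * (4 ^ K * D.real {x | s x < 0}) :=
    mul_nonneg hγ (mul_nonneg h6.le measureReal_nonneg)
  linarith

theorem potential_singleton_le (D : Measure X) [IsProbabilityMeasure D] {K : ℕ} (hK : 1 ≤ K)
    {g h : X → ℤˣ} (hg : Measurable g) (hh : Measurable h) : potential D g K [h] ≤ 4 ^ K := by
  have h1 := integral_mono (integrable_weight_margin D hK hg (List.cons_ne_nil h [])
    (by simpa using hh)) (integrable_const ((4 : ℝ) ^ K)) fun x => by
      have h2 : (margin (2 * K - 1) g [h] x) = 2 * ((0 : ℕ) : ℤ) + 1 ∨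
          (margin (2 * K - 1) g [h] x) = -(2 * ((0 : ℕ) : ℤ) + 1) := by
        rw [margin, vote]
        rcases Int.units_eq_one_or (g x) with h1 | h1 <;>
        rcases Int.units_eq_one_or (h x) with h2 | h2 <;> simp [h1, h2]
      beta_reduce
      rcases h2 with h2 | h2 <;> rw [h2]
      · rw [weight_pos_odd]
        exact pow_le_pow_right₀ (by norm_num) (by omega)
      · rw [weight_neg_odd]
        simp
  simpa [potential] using h1

/-- Markov's inequality: every point misclassified by the majority has weight at least `4^K`. -/
theorem risk_maj_le (D : Measure X) [IsProbabilityMeasure D] {K : ℕ} (hK : 1 ≤ K)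
    {g : X → ℤˣ} (hg : Measurable g) {hs : List (X → ℤˣ)} (hne : hs ≠ [])
    (hhs : ∀ h ∈ hs, Measurable h) :
    4 ^ K * risk D g (maj (2 * K - 1) hs) ≤ potential D g K hs := by
  have h1 := sum_levels_le_potential D hK hg hne hhs
  have h2 : 0 ≤ ∑ j ∈ Finset.range K, (4 : ℝ) ^ (K - 1 - j) *
      D.real {x | margin (2 * K - 1) g hs x = 2 * j + 1} :=
    Finset.sum_nonneg fun j _ => by positivity
  simp only [risk, maj_ne_iff hK g hne]
  linarith

/-! ### Numerical estimates -/

/-- The decay is `exp(-(b^3 - 1)/(4b))`, quadratic in `b = 2K - 1`, against `4^K ≤ exp(2K) = exp(b +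
1)`, linear in `b`. -/
theorem decay_mul_four_pow_le {K : ℕ} (hK : 17 ≤ K) :
    (1 - 1 / (4 * (2 * (K : ℝ) - 1))) ^ ((2 * K - 1) ^ 3 - 1) * 4 ^ K ≤ 1 := by
  have hK' : (17 : ℝ) ≤ K := by exact_mod_cast hK
  set b : ℝ := 2 * K - 1 with hbdef
  have hb : 33 ≤ b := by linarith
  have hn : (((2 * K - 1) ^ 3 - 1 : ℕ) : ℝ) = b ^ 3 - 1 := by
    rw [Nat.cast_sub (Nat.one_le_pow _ _ (by omega)), Nat.cast_pow,
      Nat.cast_sub (by omega)]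
    push_cast
    rfl
  have h0 : 0 ≤ 1 - 1 / (4 * b) := by
    have : 1 / (4 * b) ≤ 1 := by rw [div_le_one (by linarith)]; linarith
    linarith
  have h1 : (1 - 1 / (4 * b)) ^ ((2 * K - 1) ^ 3 - 1) ≤ Real.exp (-((b ^ 3 - 1) / (4 * b))) := by
    have h2 : 1 - 1 / (4 * b) ≤ Real.exp (-(1 / (4 * b))) := by
      have := Real.add_one_le_exp (-(1 / (4 * b)))
      linarith
    refine (pow_le_pow_left₀ h0 h2 _).trans_eq ?_
    rw [← Real.exp_nat_mul, hn]
    congr 1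
    field_simp
  have h2 : (4 : ℝ) ^ K ≤ Real.exp (b + 1) := by
    have h3 : (4 : ℝ) ≤ Real.exp 2 := by
      have : Real.exp 2 = Real.exp 1 * Real.exp 1 := by rw [← Real.exp_add]; norm_num
      have := Real.exp_one_gt_d9
      nlinarith
    refine (pow_le_pow_left₀ (by norm_num) h3 _).trans_eq ?_
    rw [← Real.exp_nat_mul]
    congr 1
    rw [hbdef]; ring
  have h3 : b + 1 ≤ (b ^ 3 - 1) / (4 * b) := by
    rw [le_div_iff₀ (by linarith)]
    nlinarith [mul_nonneg (show 0 ≤ b - 33 by linarith) (show 0 ≤ b ^ 2 by positivity),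
      mul_nonneg (show 0 ≤ b - 33 by linarith) (show 0 ≤ b by linarith)]
  calc _ ≤ Real.exp (-((b ^ 3 - 1) / (4 * b))) * Real.exp (b + 1) :=
        mul_le_mul h1 h2 (by positivity) (Real.exp_pos _).le
    _ = Real.exp (-((b ^ 3 - 1) / (4 * b)) + (b + 1)) := (Real.exp_add _ _).symm
    _ ≤ 1 := Real.exp_le_one_iff.2 (by linarith)

/-- The binary logarithm dominates the natural one on `[1, ∞)`, because `ln 2 ≤ 1`. -/
theorem le_exp_logb {z : ℝ} (hz : 1 ≤ z) : z ≤ Real.exp (Real.logb 2 z) := by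
  conv_lhs => rw [← Real.rpow_logb (b := 2) (by norm_num) (by norm_num) (by linarith : 0 < z)]
  rw [Real.rpow_def_of_pos (by norm_num)]
  refine Real.exp_le_exp.2 ?_
  have h1 : 0 ≤ Real.logb 2 z := Real.logb_nonneg (by norm_num) hz
  have h2 : Real.log 2 ≤ 1 := by linarith [Real.log_two_lt_d9]
  nlinarith

theorem logb_two_le_self {z : ℝ} (hz : 1 ≤ z) : Real.logb 2 z ≤ z := by
  rw [Real.logb_le_iff_le_rpow (by norm_num) (by linarith)]
  have := one_add_mul_self_le_rpow_one_add (s := 1) (by norm_num) hz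
  norm_num at this
  linarith

/-- The sample size suffices for accuracy `1 / (16 * B)` and confidence `δ / B ^ 4`. -/
theorem failure_bound {B d m : ℕ} (hB : 33 ≤ B) {δ : ℝ} (hδ0 : 0 < δ) (hδ1 : δ < 1)
    (hm : 1000 * ((d + Real.logb 2 ((B : ℝ) ^ 4) + Real.logb 2 (1 / δ)) * (B : ℝ) ^ 4) ≤ m) :
    ∃ r : ℕ, 1 ≤ r ∧ 4 * (r : ℝ) ≤ 1 / (16 * B) * m ∧
      2 * ((1 / (1 / (512 * B))) ^ d * (1 + 1 / (512 * B)) ^ (2 * m) * (1 / 2) ^ r) ≤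
        δ / (B : ℝ) ^ 4 := by
  have hb : (33 : ℝ) ≤ B := by exact_mod_cast hB
  set b : ℝ := (B : ℝ)
  set l := Real.logb 2 (b ^ 4)
  set D := Real.logb 2 (1 / δ)
  have hb4 : (1 : ℝ) ≤ b ^ 4 := one_le_pow₀ (by linarith)
  have hδ : 1 ≤ 1 / δ := by rw [le_div_iff₀ hδ0]; linarith
  have hl : 4 ≤ l := by
    rw [Real.le_logb_iff_rpow_le (by norm_num) (by linarith)]
    have : (2 : ℝ) ^ 4 ≤ b ^ 4 := pow_le_pow_left₀ (by norm_num) (by linarith) 4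
    exact_mod_cast this
  have hD : 0 ≤ D := Real.logb_nonneg (by norm_num) hδ
  have hd : (0 : ℝ) ≤ d := d.cast_nonneg
  set T := 1 / (16 * b) * m
  have hT : 60 * ((d + l + D) * b ^ 3) ≤ T := by
    simp only [T]
    rw [div_mul_eq_mul_div, one_mul, le_div_iff₀ (by linarith)]
    refine le_trans ?_ hm
    have : 0 ≤ (d + l + D) * b ^ 4 := by positivity
    nlinarith
  have hb3 : b ≤ b ^ 3 := by nlinarith [mul_nonneg (show 0 ≤ b by linarith) (show 0 ≤ b by linarith)]
  have hT2 : 60 * ((d + l + D) * b) ≤ T := by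
    refine le_trans ?_ hT
    have : 0 ≤ d + l + D := by positivity
    have := mul_le_mul_of_nonneg_left hb3 this
    linarith
  have hdb : (d : ℝ) * b ≤ T / 60 - (l + D) * b := by linarith
  have hlb : (l + D) ≤ (l + D) * b := le_mul_of_one_le_right (by positivity) (by linarith)
  have hT3 : 60 * (d * b + l + D) ≤ T := by linarith
  have hdb0 : 0 ≤ (d : ℝ) * b := by positivity
  -- Here `T = γm`, and `r` is the largest error count allowed by `4r ≤ γm`. It gives `2^(-r) ≤
  -- exp(1 - T/8)`. The choice `x = 1/(512B)` makes `(1 + x)^(2m) ≤ exp(T/16)`, half of that gain;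
  -- the rest pays for `(512B)^d ≤ exp(3dB)` and for the confidence.
  refine ⟨⌊T / 4⌋₊, Nat.one_le_floor_iff _ |>.2 (by linarith), ?_, ?_⟩
  · have := Nat.floor_le (show 0 ≤ T / 4 by linarith)
    linarith
  · have h1 : (1 / (1 / (512 * b))) ^ d ≤ Real.exp (3 * (d * b)) := by
      have h2 : 1 / (1 / (512 * b)) ≤ Real.exp (3 * b) := by
        rw [one_div_one_div]
        have h3 : b ≤ Real.exp b := by linarith [Real.add_one_le_exp b]
        have h4 : Real.exp (3 * b) = Real.exp b ^ 3 := by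
          rw [← Real.exp_nat_mul]; norm_num
        rw [h4]
        refine le_trans ?_ (pow_le_pow_left₀ (by linarith) h3 3)
        nlinarith [mul_nonneg (show 0 ≤ b - 33 by linarith) (show 0 ≤ b - 33 by linarith)]
      refine (pow_le_pow_left₀ (by positivity) h2 d).trans_eq ?_
      rw [← Real.exp_nat_mul]
      congr 1; ring
    have h2 : (1 + 1 / (512 * b)) ^ (2 * m) ≤ Real.exp (T / 16) := by
      have h3 : 1 + 1 / (512 * b) ≤ Real.exp (1 / (512 * b)) := by
        linarith [Real.add_one_le_exp (1 / (512 * b))]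
      refine (pow_le_pow_left₀ (by positivity) h3 _).trans_eq ?_
      rw [← Real.exp_nat_mul]
      congr 1
      simp only [T]
      push_cast
      field_simp
      ring
    have h3 : (1 / 2 : ℝ) ^ ⌊T / 4⌋₊ ≤ Real.exp (1 - T / 8) := by
      have h4 : (1 / 2 : ℝ) ≤ Real.exp (-(1 / 2)) := by
        linarith [Real.add_one_le_exp (-(1 / 2 : ℝ))]
      refine (pow_le_pow_left₀ (by norm_num) h4 _).trans ?_
      rw [← Real.exp_nat_mul]
      refine Real.exp_le_exp.2 ?_
      have := Nat.lt_floor_add_one (T / 4)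
      linarith
    have h4 : (2 : ℝ) ≤ Real.exp 1 := by linarith [Real.exp_one_gt_d9]
    have h6 : Real.exp (-(3 * (l + D))) ≤ δ / b ^ 4 := by
      have h7 : b ^ 4 * (1 / δ) ≤ Real.exp (l + D) := by
        rw [Real.exp_add]
        exact mul_le_mul (le_exp_logb hb4) (le_exp_logb hδ) (by positivity) (Real.exp_pos _).le
      calc Real.exp (-(3 * (l + D))) ≤ Real.exp (-(l + D)) :=
            Real.exp_le_exp.2 (by linarith)
        _ ≤ (b ^ 4 * (1 / δ))⁻¹ := by
            rw [Real.exp_neg]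
            exact inv_anti₀ (by positivity) h7
        _ = δ / b ^ 4 := by field_simp
    calc 2 * ((1 / (1 / (512 * b))) ^ d * (1 + 1 / (512 * b)) ^ (2 * m) * (1 / 2) ^ ⌊T / 4⌋₊)
        ≤ Real.exp 1 * (Real.exp (3 * (d * b)) * Real.exp (T / 16) * Real.exp (1 - T / 8)) := by
          gcongr
      _ = Real.exp (2 + 3 * (d * b) - T / 16) := by
          rw [← Real.exp_add, ← Real.exp_add, ← Real.exp_add]
          congr 1; ring
      _ ≤ Real.exp (-(3 * (l + D))) := Real.exp_le_exp.2 (by linarith)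
      _ ≤ _ := h6

/-- With `n = ⌈log(1/ε')⌉` and `K = n + 1`, one factor `2^n ≥ 1/ε'` of `4^K = 4 * 2^n * 2^n` cancels
`ε` and the other outgrows `B`. The upper bound on `B` uses that the extra factor in `1/ε'`
contributes only `17 + 4 log log(1/ε)` to the logarithm. -/
theorem clipLevel_spec {ε : ℝ} (hε0 : 0 < ε) (hε1 : ε < 1 / 32) :
    ∃ K : ℕ, clipLevel ε = 2 * K - 1 ∧ 17 ≤ K ∧ 5 * (2 * K - 1 : ℝ) ≤ 4 ^ K * ε ∧
      (2 * K - 1 : ℝ) ≤ 20 * Real.logb 2 (1 / ε) := by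
  set L := Real.logb 2 (1 / ε)
  have hε2 : (32 : ℝ) ≤ 1 / ε := by rw [le_div_iff₀ hε0]; linarith
  have hL : 5 ≤ L := by
    rw [Real.le_logb_iff_rpow_le (by norm_num) (by positivity)]
    norm_num at hε2 ⊢
    exact hε2
  set y := 1 / innerEps ε
  have hy : y = 10 ^ 5 * L ^ 4 * (1 / ε) := by
    simp only [y, innerEps]
    rw [one_div_div]
    change 10 ^ 5 * L ^ 4 / ε = _
    ring
  have hL4 : (1 : ℝ) ≤ L ^ 4 := one_le_pow₀ (by linarith)
  have hy1 : 10 ^ 5 * (1 / ε) ≤ y := by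
    rw [hy]
    have : (10 : ℝ) ^ 5 ≤ 10 ^ 5 * L ^ 4 := by linarith
    exact mul_le_mul_of_nonneg_right this (by positivity)
  have hy0 : 0 < y := by
    have : (0 : ℝ) < 10 ^ 5 * (1 / ε) := by positivity
    linarith
  have hlog0 : 0 ≤ Real.logb 2 y := Real.logb_nonneg (by norm_num) (by linarith)
  set n := ⌈Real.logb 2 y⌉₊
  have hn1 : Real.logb 2 y ≤ n := Nat.le_ceil _
  have hn2 : (n : ℝ) < Real.logb 2 y + 1 := Nat.ceil_lt_add_one hlog0
  have hyn : y ≤ 2 ^ n := by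
    have := (Real.logb_le_iff_le_rpow (by norm_num) hy0).1 hn1
    exact_mod_cast this
  refine ⟨n + 1, ?_, ?_, ?_, ?_⟩
  · change 2 * n + 1 = _
    omega
  · by_contra! hlt
    have h1 : (2 : ℝ) ^ n ≤ 2 ^ 15 := pow_le_pow_right₀ (by norm_num) (by omega)
    linarith
  · have h1 : (2 : ℝ) * n + 1 ≤ 2 * 2 ^ n := by
      have : n + 1 ≤ 2 ^ n := Nat.lt_two_pow_self
      have : (n : ℝ) + 1 ≤ 2 ^ n := by exact_mod_cast this
      linarith
    have h2 : 5 ≤ 2 ^ n * ε := by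
      have h3 : 10 ^ 5 * (1 / ε) * ε = 10 ^ 5 := by field_simp
      have h4 := mul_le_mul_of_nonneg_right (hy1.trans hyn) hε0.le
      linarith
    have h5 : (4 : ℝ) ^ (n + 1) = 4 * (2 ^ n * 2 ^ n) := by
      rw [← mul_pow, pow_succ]; norm_num; ring
    have h6 : (0 : ℝ) < 2 ^ n := by positivity
    have h7 := mul_le_mul_of_nonneg_left h2 h6.le
    rw [h5]
    push_cast
    linarith
  · have h1 : Real.logb 2 y ≤ 17 + 4 * L + L := by
      rw [hy, Real.logb_mul (by positivity) (by positivity),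
        Real.logb_mul (by positivity) (by positivity)]
      have h4 : Real.logb 2 (L ^ 4) = 4 * Real.logb 2 L := by
        rw [Real.logb_pow]; norm_num
      have h2 : Real.logb 2 (10 ^ 5) ≤ 17 := by
        rw [Real.logb_le_iff_le_rpow (by norm_num) (by norm_num)]
        norm_num
      have h3 := logb_two_le_self (show 1 ≤ L by linarith)
      change _ + L ≤ _
      linarith
    push_cast
    linarith

theorem length_oddLevels {K : ℕ} (hK : 1 ≤ K) : (oddLevels (2 * K - 1)).length = K := by
  have h : ∀ k : ℕ, ((List.range (2 * k)).filter fun v => v % 2 = 1).length = k := by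
    intro k
    induction k with
    | zero => simp
    | succ k ih =>
      rw [Nat.mul_succ, List.range_succ, List.range_succ, List.append_assoc, List.filter_append,
        List.length_append, ih]
      simp
  rw [oddLevels, Nat.sub_add_cancel (by omega)]
  exact h K

/-- Bernoulli's inequality in place of a union bound over `N ≤ B^4` batches. -/
theorem one_sub_le_pow {B : ℕ} (hB : 1 ≤ B) {δ : ℝ} (hδ0 : 0 < δ) (hδ1 : δ < 1) {c : ℝ≥0∞}
    (hc : 1 - ENNReal.ofReal (δ / (B : ℝ) ^ 4) ≤ c) {N : ℕ} (hN : N ≤ B ^ 4) :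
    ENNReal.ofReal (1 - δ) ≤ c ^ N := by
  have hB4 : (1 : ℝ) ≤ (B : ℝ) ^ 4 := one_le_pow₀ (by exact_mod_cast hB)
  have h0 : 0 ≤ δ / (B : ℝ) ^ 4 := by positivity
  have h1 : δ / (B : ℝ) ^ 4 ≤ 1 := by rw [div_le_one (by linarith)]; linarith
  rw [← ENNReal.ofReal_one, ← ENNReal.ofReal_sub _ h0] at hc
  refine le_trans ?_ (pow_le_pow_left₀ zero_le hc N)
  rw [← ENNReal.ofReal_pow (by linarith)]
  refine ENNReal.ofReal_le_ofReal ?_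
  have h2 := one_add_mul_le_pow (show -2 ≤ -(δ / (B : ℝ) ^ 4) by linarith) N
  have h3 : (N : ℝ) * (δ / (B : ℝ) ^ 4) ≤ δ := by
    have h4 : (N : ℝ) ≤ (B : ℝ) ^ 4 := by exact_mod_cast hN
    calc (N : ℝ) * (δ / (B : ℝ) ^ 4) ≤ (B : ℝ) ^ 4 * (δ / (B : ℝ) ^ 4) :=
          mul_le_mul_of_nonneg_right h4 h0
      _ = δ := by field_simp
  rw [← sub_eq_add_neg] at h2
  linarith

/-! ### The learner -/

theorem numRounds_one (ε : ℝ) : numRounds 1 ε = clipLevel ε ^ 3 := by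
  rw [numRounds, one_mul, ← Nat.cast_pow, Nat.ceil_natCast]

theorem eqLearns_eqLearner {X : Type u} [MeasurableSpace X] {ε δ : ℝ} (hε0 : 0 < ε)
    (hε1 : ε < 1 / 32) (hδ0 : 0 < δ) (hδ1 : δ < 1) {d : ℕ} {H : Set (X → ℤˣ)}
    (hd : HasVCDim H d) (hH : IsMeasurableClass H) {FC : List (X × ℤˣ) → X → ℤˣ}
    (hFC : IsFindConsistent H FC) {h₁ : X → ℤˣ} (h₁H : h₁ ∈ H) :
    EQLearns (eqLearner 1000 1 FC h₁ d ε δ) H ε δ := by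
  intro g hg D _
  obtain ⟨K, hKB, hK, hKε, -⟩ := clipLevel_spec hε0 hε1
  have hK1 : 1 ≤ K := by omega
  have hgm := hH.measurable g hg
  have hcast : ((2 * K - 1 : ℕ) : ℝ) = 2 * K - 1 := by
    rw [Nat.cast_sub (by omega)]; push_cast; rfl
  set m := sampleSize 1000 d ε δ
  obtain ⟨r, hr1, hr2, hr3⟩ := failure_bound (B := 2 * K - 1) (d := d) (m := m) (by omega) hδ0 hδ1
    (by rw [← hKB]; exact Nat.le_ceil _)
  have hK' : (17 : ℝ) ≤ K := by exact_mod_cast hK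
  have hb : (33 : ℝ) ≤ 2 * K - 1 := by linarith
  set c : ℝ≥0∞ := 1 - ENNReal.ofReal (δ / ((2 * K - 1 : ℕ) : ℝ) ^ 4)
  have hc : ∀ f : X → ℤˣ, Measurable f → c ≤ (sampleEQ f m).prob D g
      {S | GoodSample H D g (1 / (16 * ((2 * K - 1 : ℕ) : ℝ))) {f} S} := by
    intro f hf
    refine le_trans ?_ (le_prob_goodSample hH hd hg D hr1 hr2
      (x := 1 / (512 * ((2 * K - 1 : ℕ) : ℝ))) ?_ ?_ hf)
    · exact tsub_le_tsub_left (ENNReal.ofReal_le_ofReal hr3) _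
    · rw [hcast]; positivity
    · rw [hcast, div_le_one (by linarith)]; linarith
  rw [hcast] at hc
  set q : ℝ := 1 - 1 / (4 * (2 * (K : ℝ) - 1))
  have hq0 : 0 ≤ q := by
    have : 1 / (4 * (2 * (K : ℝ) - 1)) ≤ 1 := by rw [div_le_one (by linarith)]; linarith
    simp only [q]; linarith
  set n := (2 * K - 1) ^ 3 - 1
  have hsteps := le_prob_steps hH hg hc hFC
    -- Here `k` counts the rounds still to come, and `4B` is the fixed point of the recursion `p ↦ q
    -- * p + 1`. The excess over it shrinks by `q` per round, so this bound is preserved and gives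
    -- potential at most `4B + 1 ≤ 5B` at `k = 0`.
    (fun k hs => hs ≠ [] ∧ q ^ k * (potential D g K hs - 4 * (2 * K - 1)) ≤ 1)
    (fun k hs hhs h hh hgood hI => by
      refine ⟨List.cons_ne_nil _ _, le_trans ?_ hI.2⟩
      rw [pow_succ, mul_assoc]
      refine mul_le_mul_of_nonneg_left ?_ (pow_nonneg hq0 k)
      have h1 := potential_cons_le D hK1 hgm (hH.measurable h hh) hI.1
        (fun k hk => hH.measurable k (hhs k hk)) hgood
      have h2 : q * (4 * (2 * K - 1)) = 4 * (2 * K - 1) - 1 := by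
        simp only [q]
        have : (2 * (K : ℝ) - 1) ≠ 0 := by linarith
        field_simp
      change _ ≤ q * _ + 1 at h1
      rw [mul_sub q, h2]
      linarith) n (hs := [h₁]) (by simpa using h₁H) ⟨List.cons_ne_nil _ _, by
        have h1 := potential_singleton_le D hK1 hgm (hH.measurable h₁ h₁H)
        refine le_trans ?_ (decay_mul_four_pow_le hK)
        exact mul_le_mul_of_nonneg_left (by linarith) (pow_nonneg hq0 _)⟩
  have hret := EQProg.prob_bind_ge D g (steps FC (2 * K - 1) m n [h₁])
    (fun hs => EQProg.ret (maj (2 * K - 1) hs)) _ {f | risk D g f ≤ ε} (c := 1)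
    (fun hs (hhs : (∀ h ∈ hs, h ∈ H) ∧ hs ≠ [] ∧
        q ^ 0 * (potential D g K hs - 4 * (2 * K - 1)) ≤ 1) => by
      obtain ⟨h1, h2, h3⟩ := hhs
      rw [EQProg.prob, if_pos]
      have h4 := risk_maj_le D hK1 hgm h2 fun h hh => hH.measurable h (h1 h hh)
      rw [pow_zero, one_mul] at h3
      have h5 : (0 : ℝ) < 4 ^ K := by positivity
      exact le_of_mul_le_mul_left (by linarith) h5)
  rw [mul_one] at hret
  have hprog : eqLearner 1000 1 FC h₁ d ε δ =
      (steps FC (2 * K - 1) m n [h₁]).bind fun hs => EQProg.ret (maj (2 * K - 1) hs) := by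
    simp only [n, ← hKB, ← numRounds_one]
    rfl
  rw [hprog]
  refine (one_sub_le_pow (B := 2 * K - 1) (by omega) hδ0 hδ1 le_rfl ?_).trans (hsteps.trans hret)
  -- Each round has `K + 1 ≤ B` batches and there are fewer than `B^3` rounds, whence the `B^4` in
  -- the sample size.
  rw [length_oddLevels hK1, pow_succ' _ 3]
  exact Nat.mul_le_mul (by omega) (Nat.sub_le _ _)

theorem exists_asksAtMost_eqLearner {X : Type u} {ε δ : ℝ} (hε0 : 0 < ε)
    (hε1 : ε < 1 / 32) (hδ0 : 0 < δ) (hδ1 : δ < 1) (d : ℕ)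
    (FC : List (X × ℤˣ) → X → ℤˣ) (h₁ : X → ℤˣ) :
    ∃ q : ℕ, (eqLearner 1000 1 FC h₁ d ε δ).AsksAtMost q ∧
      (q : ℝ) ≤ 10 ^ 4 * 20 ^ 9 *
        (((max d 1 : ℕ) + Real.logb 2 (1 / δ)) * Real.logb 2 (1 / ε) ^ 9) := by
  obtain ⟨K, hKB, hK, -, hKL⟩ := clipLevel_spec hε0 hε1
  have hcast : ((2 * K - 1 : ℕ) : ℝ) = 2 * K - 1 := by
    rw [Nat.cast_sub (by omega)]; push_cast; rfl
  have hK' : (17 : ℝ) ≤ K := by exact_mod_cast hK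
  rw [← hcast] at hKL
  set B := 2 * K - 1
  have hb : (33 : ℝ) ≤ B := by rw [hcast]; linarith
  set m := sampleSize 1000 d ε δ
  refine ⟨B ^ 4 * m, ?_, ?_⟩
  · have h := (asksAtMost_steps FC (clipLevel ε) m (numRounds 1 ε - 1) [h₁]).bind (k := 0)
      (F := fun hs => EQProg.ret (maj (clipLevel ε) hs)) fun _ => EQProg.AsksAtMost.ret _ _
    refine h.mono ?_
    rw [numRounds_one, hKB, length_oddLevels (by omega), pow_succ _ 3, add_zero, mul_assoc]
    exact Nat.mul_le_mul (Nat.sub_le _ _) (Nat.mul_le_mul_right _ (by omega))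
  · set b : ℝ := (B : ℝ)
    set D := Real.logb 2 (1 / δ)
    set M : ℝ := ((max d 1 : ℕ) : ℝ)
    have hδ : 1 ≤ 1 / δ := by rw [le_div_iff₀ hδ0]; linarith
    have hD : 0 ≤ D := Real.logb_nonneg (by norm_num) hδ
    have hM : 1 ≤ M := Nat.one_le_cast.2 (le_max_right d 1)
    have hdM : (d : ℝ) ≤ M := Nat.cast_le.2 (le_max_left d 1)
    -- This crude bound makes `m` of order `B^5`; with the `B^4` batches this yields the ninth
    -- power. As `M ≥ 1`, the term is absorbed into `5b(M + D)` even for `d = 0`.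
    have hl : Real.logb 2 (b ^ 4) ≤ 4 * b := by
      rw [Real.logb_pow]
      have := logb_two_le_self (show 1 ≤ b by linarith)
      push_cast
      linarith
    have hl0 : 0 ≤ Real.logb 2 (b ^ 4) :=
      Real.logb_nonneg (by norm_num) (one_le_pow₀ (by linarith))
    have hb4 : (1 : ℝ) ≤ b ^ 4 := one_le_pow₀ (by linarith)
    have hsum : d + Real.logb 2 (b ^ 4) + D ≤ 5 * b * (M + D) := by
      nlinarith [mul_nonneg (show 0 ≤ b - 1 by linarith) hD,
        mul_nonneg (show 0 ≤ b by linarith) (show 0 ≤ M - 1 by linarith)]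
    have hm : (m : ℝ) ≤ 10 ^ 4 * (b ^ 5 * (M + D)) := by
      have h1 : (m : ℝ) < 1000 * ((d + Real.logb 2 (b ^ 4) + D) * b ^ 4) + 1 := by
        simp only [m, sampleSize, hKB]
        exact Nat.ceil_lt_add_one (by positivity)
      have h2 := mul_le_mul_of_nonneg_right hsum (show 0 ≤ b ^ 4 by linarith)
      have h3 : 5 * b * (M + D) * b ^ 4 = 5 * (b ^ 5 * (M + D)) := by ring
      have h4 : 1 ≤ b ^ 5 * (M + D) :=
        one_le_mul_of_one_le_of_one_le (one_le_pow₀ (by linarith)) (by linarith)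
      linarith
    push_cast
    calc b ^ 4 * (m : ℝ) ≤ b ^ 4 * (10 ^ 4 * (b ^ 5 * (M + D))) :=
          mul_le_mul_of_nonneg_left hm (by linarith)
      _ = 10 ^ 4 * (M + D) * b ^ 9 := by ring
      _ ≤ 10 ^ 4 * (M + D) * (20 * Real.logb 2 (1 / ε)) ^ 9 := by gcongr
      _ = _ := by ring

end EQL

theorem mainTheorem1 :
    ∃ a b C : ℝ, 0 < a ∧ 0 < b ∧ 0 < C ∧
      ∀ (X : Type u) [MeasurableSpace X] (ε δ : ℝ), 0 < ε → ε < 1 / 32 → 0 < δ → δ < 1 →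
      ∀ (d : ℕ) (H : Set (X → ℤˣ)), EQL.HasVCDim H d → EQL.IsMeasurableClass H →
      ∀ FC : List (X × ℤˣ) → X → ℤˣ, EQL.IsFindConsistent H FC → ∀ h₁ ∈ H,
        EQL.EQLearns (EQL.eqLearner a b FC h₁ d ε δ) H ε δ ∧
        ∃ q : ℕ, (EQL.eqLearner a b FC h₁ d ε δ).AsksAtMost q ∧
          (q : ℝ) ≤ C * (((max d 1 : ℕ) + Real.logb 2 (1 / δ)) * Real.logb 2 (1 / ε) ^ 9) :=
  ⟨1000, 1, 10 ^ 4 * 20 ^ 9, by norm_num, by norm_num, by norm_num,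
    fun _ _ _ _ hε0 hε1 hδ0 hδ1 d _ hd hH FC hFC h₁ h₁H =>
      ⟨EQL.eqLearns_eqLearner hε0 hε1 hδ0 hδ1 hd hH hFC h₁H,
        EQL.exists_asksAtMost_eqLearner hε0 hε1 hδ0 hδ1 d FC h₁⟩⟩
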